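/- All algebras are associative unital $\mathbf C$-algebras. For an algebra $R$ let $R^{\rm Lie}_1=R$ and $R^{\rm Lie}_{i+1}=[R,R^{\rm Lie}_i]$ be the lower central series for the bracket $[a,b]=ab-ba$, let $$F^dR=\sum_{m}\ \sum_{i_1+\dots+i_m-m=d} R\cdot R^{\rm Lie}_{i_1}\cdot R\cdots R\cdot R^{\rm Lie}_{i_m}\cdot R$$ be the NC-filtration (a decreasing filtration by two-sided ideals), and let $R_{ab}=R/F^1R$ be the commutativization. Let $\mathcal N_d$ be the category of algebras $\Lambda$ with $F^{d+1}\Lambda=0$. An algebra $R$ is called *$d$-smooth* ($d\ge 0$) if it is finitely generated, $R\in\mathcal N_d$, and for every surjection $\Lambda'\to\Lambda$ in $\mathcal N_d$ with nilpotent kernel the map $\mathrm{Hom}(R,\Lambda')\to\mathrm{Hom}(R,\Lambda)$ is surjective. It is called *NC-smooth* if $R\to\varprojlim_d R/F^dR$ is an isomorphism and $R/F^{d+1}R$ is $d$-smooth for every $d\ge 0$. A *$d$-smooth* (resp. *NC-smooth*) *thickening* of a commutative algebra $A$ is a $d$-smooth (resp. NC-smooth) algebra $R$ together with an isomorphism $R_{ab}\to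 A$. **Theorem.** Let $A$ be a finitely generated smooth commutative $\mathbf C$-algebra. (a) For every $d\ge 0$, $A$ has a $d$-smooth thickening, and for any two $d$-smooth thickenings $R,R'$ of $A$ there is an algebra isomorphism $R\to R'$ compatible with the projections $R\to R_{ab}\cong A$ and $R'\to R'_{ab}\cong A$. (b) $A$ has an NC-smooth thickening, and for any two NC-smooth thickenings $R,R'$ of $A$ there is an algebra isomorphism $R\to R'$ compatible with the projections to $A$. (c) Let $d\ge0$, let $R$ be any $d$-smooth algebra and let $H=H_2(R,R_{ab})$ be the Hochschild homology, an $R_{ab}$-module. Then $R$ has a universal central extension, that is, a central extension $0\to H\to R^\tau\to R\to 0$ (in which $R^\tau$ acts on $H$ from both sides through $R^\tau\to R\to R_{ab}$) whose class in $H^2(R,H)$ is the tautological one: for a $\mathbf C$-linear section $s$ and the cocycle $c(x,y)=s(x)s(y)-s(xy)\in H$, the map $H_2(R,R_{ab})\to H$ induced by $a\otimes x\otimes y\mapsto a\,c(x,y)$ is the identity. For every universal central extension $R^\tau\to R$, the algebra $R^\tau$ is $(d+1)$-smooth, and $R^\tau\to R$ induces an isomorphism $R^\tau_{ab}\to R_{ab}$.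 In particular, if $R$ is a $d$-smooth thickening of $A$, then $R^\tau$ is a $(d+1)$-smooth thickening of $A$. -/

import Mathlib

open scoped TensorProduct

universe u

section NCFiltration

variable (R : Type u) [Ring R] [Algebra ℂ R]

attribute [local instance] LieRing.ofAssociativeRing

/-- `lieLower R k` is the term with `k` brackets of the lower central series of the Lie algebra
`(R, [a, b] = ab - ba)`; it is spanned by the iterated commutators
`[x₁, [x₂, … [xₖ, xₖ₊₁]…]]`. So `lieLower R 0 = R`. -/
def lieLower (k : ℕ) : Submodule ℂ R :=
  (LieModule.lowerCentralSeries ℂ R R k).toSubmodule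

theorem lieLower_zero : lieLower R 0 = ⊤ := by
  simp [lieLower]

theorem lieLower_succ_le (k : ℕ) : lieLower R (k + 1) ≤ lieLower R k :=
  LieModule.antitone_lowerCentralSeries ℂ R R (Nat.le_succ k)

theorem commutator_mem_lieLower_one (x y : R) : x * y - y * x ∈ lieLower R 1 := by
  have h : ⁅x, y⁆ ∈ LieModule.lowerCentralSeries ℂ R R 1 := by
    rw [LieModule.lowerCentralSeries_succ]
    exact LieSubmodule.lie_mem_lie (LieSubmodule.mem_top x) (by simp)
  exact h

/-- For a list `[k₁, …, kₘ]`, the span of all products in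
`R · L_{k₁} · R · L_{k₂} · R ⋯ R · L_{kₘ} · R`, where `L_k` is `lieLower R k`. -/
def ncProduct (l : List ℕ) : Submodule ℂ R :=
  ⊤ * (l.map fun k => lieLower R k * ⊤).prod

/-- The `d`-th term of the NC-filtration as a linear subspace: the sum of all
`R · L_{k₁} · R ⋯ R · L_{kₘ} · R` with `d` commutator brackets in total. -/
def ncFiltrationSubmodule (d : ℕ) : Submodule ℂ R :=
  ⨆ l : {l : List ℕ // l.sum = d}, ncProduct R l.1

theorem top_mul_top : (⊤ : Submodule ℂ R) * ⊤ = ⊤ :=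
  top_le_iff.1 fun x _ => by
    simpa using Submodule.mul_mem_mul (Submodule.mem_top (x := x) (R := ℂ))
      (Submodule.mem_top (x := (1 : R)) (R := ℂ))

theorem top_mul_ncProduct (l : List ℕ) : ⊤ * ncProduct R l = ncProduct R l := by
  rw [ncProduct, ← mul_assoc, top_mul_top]

theorem ncProduct_mul_top (l : List ℕ) : ncProduct R l * ⊤ = ncProduct R l := by
  induction l using List.reverseRecOn with
  | nil => simp [ncProduct, top_mul_top]
  | append_singleton l k _ => simp [ncProduct, mul_assoc, top_mul_top]

/-- The NC-filtration `F^d R` of an associative algebra, a decreasing sequence of two-sided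
ideals. -/
def ncFiltration (d : ℕ) : Ideal R where
  carrier := ncFiltrationSubmodule R d
  add_mem' := (ncFiltrationSubmodule R d).add_mem
  zero_mem' := (ncFiltrationSubmodule R d).zero_mem
  smul_mem' := fun c x hx => by
    have h : ⊤ * ncFiltrationSubmodule R d ≤ ncFiltrationSubmodule R d := by
      simp only [ncFiltrationSubmodule, Submodule.mul_iSup, top_mul_ncProduct, le_refl]
    exact h (Submodule.mul_mem_mul (Submodule.mem_top (x := c)) hx)

instance ncFiltration_isTwoSided (d : ℕ) : (ncFiltration R d).IsTwoSided where
  mul_mem_of_left := fun {a} b ha => by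
    have h : ncFiltrationSubmodule R d * ⊤ ≤ ncFiltrationSubmodule R d := by
      simp only [ncFiltrationSubmodule, Submodule.iSup_mul, ncProduct_mul_top, le_refl]
    exact h (Submodule.mul_mem_mul ha (Submodule.mem_top (x := b)))

theorem exists_ncProduct_le (l : List ℕ) (d : ℕ) (h : l.sum = d + 1) :
    ∃ l' : List ℕ, l'.sum = d ∧ ncProduct R l ≤ ncProduct R l' := by
  suffices H : ∀ (l : List ℕ) (d : ℕ), l.sum = d + 1 → ∃ l' : List ℕ, l'.sum = d ∧
      (l.map fun k => lieLower R k * ⊤).prod ≤ (l'.map fun k => lieLower R k * ⊤).prod by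
    obtain ⟨l', h1, h2⟩ := H l d h
    exact ⟨l', h1, mul_le_mul' le_rfl h2⟩
  intro l
  induction l with
  | nil => intro d h; simp at h
  | cons k l ih =>
    intro d h
    rcases k with _ | k
    · obtain ⟨l', h1, h2⟩ := ih d (by simpa using h)
      refine ⟨0 :: l', by simpa using h1, ?_⟩
      simp only [List.map_cons, List.prod_cons]
      exact mul_le_mul' le_rfl h2
    · refine ⟨k :: l, by simp at h ⊢; omega, ?_⟩
      simp only [List.map_cons, List.prod_cons]
      exact mul_le_mul'
        (mul_le_mul' (lieLower_succ_le R k) le_rfl) le_rfl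

theorem ncFiltration_succ_le (d : ℕ) : ncFiltration R (d + 1) ≤ ncFiltration R d := by
  have h : ncFiltrationSubmodule R (d + 1) ≤ ncFiltrationSubmodule R d := by
    refine iSup_le fun l => ?_
    obtain ⟨l', h1, h2⟩ := exists_ncProduct_le R l.1 d l.2
    exact h2.trans (le_iSup (fun l : {l : List ℕ // l.sum = d} => ncProduct R l.1) ⟨l', h1⟩)
  exact h

theorem commutator_mem_ncFiltration_one (x y : R) : x * y - y * x ∈ ncFiltration R 1 := by
  have h : ncProduct R [1] ≤ ncFiltrationSubmodule R 1 :=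
    le_iSup (fun l : {l : List ℕ // l.sum = 1} => ncProduct R l.1) ⟨[1], rfl⟩
  refine h ?_
  have := Submodule.mul_mem_mul (Submodule.mem_top (x := (1 : R)) (R := ℂ))
    (Submodule.mul_mem_mul (commutator_mem_lieLower_one R x y)
      (Submodule.mem_top (x := (1 : R)) (R := ℂ)))
  simpa [ncProduct] using this

end NCFiltration

section Abelianization

variable (R : Type u) [Ring R] [Algebra ℂ R]

/-- The commutativization `R_ab = R / F¹R`, the quotient by the two-sided ideal generated by
all commutators. -/
def NCAb : Type u := R ⧸ ncFiltration R 1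

instance NCAb.instRing : Ring (NCAb R) :=
  inferInstanceAs (Ring (R ⧸ ncFiltration R 1))

instance NCAb.instCommRing : CommRing (NCAb R) :=
  { NCAb.instRing R with
    mul_comm := by
      intro a b
      obtain ⟨x, rfl⟩ := Ideal.Quotient.mk_surjective (I := ncFiltration R 1) a
      obtain ⟨y, rfl⟩ := Ideal.Quotient.mk_surjective (I := ncFiltration R 1) b
      exact Ideal.Quotient.eq.2 (commutator_mem_ncFiltration_one R x y) }

instance NCAb.instAlgebra : Algebra ℂ (NCAb R) :=
  inferInstanceAs (Algebra ℂ (R ⧸ ncFiltration R 1))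

/-- The canonical surjection `R → R_ab`. -/
def NCAb.mk : R →ₐ[ℂ] NCAb R := Ideal.Quotient.mkₐ ℂ (ncFiltration R 1)

end Abelianization

section Smoothness

/-- `R` is NC-nilpotent of degree `d`: `F^{d+1} R = 0`. -/
def IsNCNilpotent (d : ℕ) (R : Type u) [Ring R] [Algebra ℂ R] : Prop :=
  ncFiltration R (d + 1) = ⊥

/-- `Λ ↦ Hom(R, Λ)`, restricted to the algebras that are NC-nilpotent of degree `d`, is formally
smooth: homomorphisms from `R` lift along surjections with nilpotent kernel. -/
def IsFormallyNCSmooth (d : ℕ) (R : Type u) [Ring R] [Algebra ℂ R] : Prop :=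
  ∀ (Λ' Λ : Type u) [Ring Λ'] [Algebra ℂ Λ'] [Ring Λ] [Algebra ℂ Λ],
    IsNCNilpotent d Λ' → IsNCNilpotent d Λ →
    ∀ p : Λ' →ₐ[ℂ] Λ, Function.Surjective p → IsNilpotent (RingHom.ker p) →
    ∀ f : R →ₐ[ℂ] Λ, ∃ g : R →ₐ[ℂ] Λ', p.comp g = f

/-- `d`-smooth algebras. -/
structure IsDSmooth (d : ℕ) (R : Type u) [Ring R] [Algebra ℂ R] : Prop where
  finiteType : Algebra.FiniteType ℂ R
  ncNilpotent : IsNCNilpotent d R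
  formallySmooth : IsFormallyNCSmooth d R

variable (R : Type u) [Ring R] [Algebra ℂ R]

/-- The NC-completion: the inverse limit of the algebras `R / F^d R`. -/
def NCCompletion : Subalgebra ℂ (∀ d : ℕ, R ⧸ ncFiltration R d) where
  carrier := {x | ∀ d, Ideal.Quotient.factorₐ ℂ (ncFiltration_succ_le R d) (x (d + 1)) = x d}
  mul_mem' := fun hx hy d => by
    rw [Pi.mul_apply, map_mul, hx d, hy d, Pi.mul_apply]
  add_mem' := fun hx hy d => by
    rw [Pi.add_apply, map_add, hx d, hy d, Pi.add_apply]
  algebraMap_mem' := fun c d => by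
    rw [Pi.algebraMap_apply, AlgHom.commutes, Pi.algebraMap_apply]

/-- The natural homomorphism `R → lim R / F^d R`. -/
def toNCCompletion : R →ₐ[ℂ] NCCompletion R :=
  (AlgHom.pi fun d => Ideal.Quotient.mkₐ ℂ (ncFiltration R d)).codRestrict
    (NCCompletion R) fun _ _ => rfl

/-- `R` is NC-complete: `R → lim R / F^d R` is an isomorphism. -/
def IsNCComplete : Prop := Function.Bijective (toNCCompletion R)

/-- NC-smooth algebras. -/
structure IsNCSmooth : Prop where
  ncComplete : IsNCComplete R
  quotient_dSmooth : ∀ d : ℕ, IsDSmooth d (R ⧸ ncFiltration R (d + 1))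

/-- A `d`-smooth thickening of a commutative algebra `A`: a `d`-smooth algebra `R` together with
an isomorphism `R_ab → A`. -/
structure DSmoothThickening (d : ℕ) (A : Type u) [CommRing A] [Algebra ℂ A]
    (R : Type u) [Ring R] [Algebra ℂ R] where
  dSmooth : IsDSmooth d R
  iso : NCAb R ≃ₐ[ℂ] A

/-- An NC-smooth thickening of a commutative algebra `A`: an NC-smooth algebra `R` together with
an isomorphism `R_ab → A`. -/
structure NCSmoothThickening (A : Type u) [CommRing A] [Algebra ℂ A]
    (R : Type u) [Ring R] [Algebra ℂ R] where
  ncSmooth : IsNCSmooth R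
  iso : NCAb R ≃ₐ[ℂ] A

end Smoothness

noncomputable section Hochschild

variable (R : Type u) [Ring R] [Algebra ℂ R]

/-- The boundary `C₂(R, R_ab) → C₁(R, R_ab)` of the Hochschild complex,
`a ⊗ x ⊗ y ↦ a x ⊗ y - a ⊗ x y + y a ⊗ x`, linear over `R_ab`. -/
def hochschildBoundaryTwo :
    NCAb R ⊗[ℂ] (R ⊗[ℂ] R) →ₗ[NCAb R] NCAb R ⊗[ℂ] R :=
  LinearMap.liftBaseChange (NCAb R)
    (TensorProduct.map (NCAb.mk R).toLinearMap LinearMap.id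
      - TensorProduct.mk ℂ (NCAb R) R 1 ∘ₗ LinearMap.mul' ℂ R
      + TensorProduct.map (NCAb.mk R).toLinearMap LinearMap.id ∘ₗ
          (TensorProduct.comm ℂ R R).toLinearMap)

theorem hochschildBoundaryTwo_tmul (a : NCAb R) (x y : R) :
    hochschildBoundaryTwo R (a ⊗ₜ (x ⊗ₜ y)) =
      (a * NCAb.mk R x) ⊗ₜ y - a ⊗ₜ (x * y) + (NCAb.mk R y * a) ⊗ₜ x := by
  simp [hochschildBoundaryTwo, TensorProduct.smul_tmul', mul_comm]

/-- The boundary `C₃(R, R_ab) → C₂(R, R_ab)` of the Hochschild complex,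
`a ⊗ x ⊗ y ⊗ z ↦ a x ⊗ y ⊗ z - a ⊗ x y ⊗ z + a ⊗ x ⊗ y z - z a ⊗ x ⊗ y`,
linear over `R_ab`. -/
def hochschildBoundaryThree :
    NCAb R ⊗[ℂ] (R ⊗[ℂ] (R ⊗[ℂ] R)) →ₗ[NCAb R] NCAb R ⊗[ℂ] (R ⊗[ℂ] R) :=
  LinearMap.liftBaseChange (NCAb R)
    (TensorProduct.map (NCAb.mk R).toLinearMap LinearMap.id
      - TensorProduct.mk ℂ (NCAb R) (R ⊗[ℂ] R) 1 ∘ₗ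
          TensorProduct.map (LinearMap.mul' ℂ R) LinearMap.id ∘ₗ
          (TensorProduct.assoc ℂ R R R).symm.toLinearMap
      + TensorProduct.mk ℂ (NCAb R) (R ⊗[ℂ] R) 1 ∘ₗ
          TensorProduct.map LinearMap.id (LinearMap.mul' ℂ R)
      - TensorProduct.map (NCAb.mk R).toLinearMap LinearMap.id ∘ₗ
          (TensorProduct.comm ℂ (R ⊗[ℂ] R) R).toLinearMap ∘ₗ
          (TensorProduct.assoc ℂ R R R).symm.toLinearMap)

theorem hochschildBoundaryThree_tmul (a : NCAb R) (x y z : R) :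
    hochschildBoundaryThree R (a ⊗ₜ (x ⊗ₜ (y ⊗ₜ z))) =
      (a * NCAb.mk R x) ⊗ₜ (y ⊗ₜ z) - a ⊗ₜ ((x * y) ⊗ₜ z) + a ⊗ₜ (x ⊗ₜ (y * z))
        - (NCAb.mk R z * a) ⊗ₜ (x ⊗ₜ y) := by
  simp [hochschildBoundaryThree, smul_add, smul_sub, TensorProduct.smul_tmul', mul_comm]

theorem hochschildBoundaryTwo_boundaryThree (w : NCAb R ⊗[ℂ] (R ⊗[ℂ] (R ⊗[ℂ] R))) :
    hochschildBoundaryTwo R (hochschildBoundaryThree R w) = 0 := by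
  induction w using TensorProduct.induction_on with
  | zero => simp
  | add w₁ w₂ h₁ h₂ => simp [h₁, h₂]
  | tmul a w =>
    induction w using TensorProduct.induction_on with
    | zero => simp
    | add w₁ w₂ h₁ h₂ => simp [TensorProduct.tmul_add, h₁, h₂]
    | tmul x w =>
      induction w using TensorProduct.induction_on with
      | zero => simp
      | add w₁ w₂ h₁ h₂ => simp [TensorProduct.tmul_add, h₁, h₂]
      | tmul y z =>
        simp only [hochschildBoundaryThree_tmul, map_sub, map_add, hochschildBoundaryTwo_tmul,
          map_mul, mul_assoc]
        rw [mul_comm (NCAb.mk R z) a]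
        abel

/-- Hochschild homology `H₂(R, R_ab) = Z₂ / B₂`, a module over `R_ab`, realized as the image of the
2-cycles `Z₂` in the quotient `C₂ / B₂` of the 2-chains by the 2-boundaries. -/
abbrev HochschildH2 : Type u :=
  (LinearMap.ker (hochschildBoundaryTwo R)).map (LinearMap.range (hochschildBoundaryThree R)).mkQ

variable {R} in
/-- The class in `H₂(R, R_ab)` of a Hochschild 2-cycle. -/
def HochschildH2.mk (z : NCAb R ⊗[ℂ] (R ⊗[ℂ] R)) (hz : hochschildBoundaryTwo R z = 0) :
    HochschildH2 R :=
  ⟨(LinearMap.range (hochschildBoundaryThree R)).mkQ z, Submodule.mem_map_of_mem hz⟩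

variable {R}

/-- The pairing of a bilinear map `c : R × R → M` (a Hochschild 2-cochain) with 2-chains,
`a ⊗ x ⊗ y ↦ a • c(x, y)`. -/
def hochschildPairing {M : Type u} [AddCommGroup M] [Module ℂ M] [Module (NCAb R) M]
    [IsScalarTower ℂ (NCAb R) M] (c : R →ₗ[ℂ] R →ₗ[ℂ] M) :
    NCAb R ⊗[ℂ] (R ⊗[ℂ] R) →ₗ[NCAb R] M :=
  LinearMap.liftBaseChange (NCAb R) (TensorProduct.lift c)

variable (R)

/-- A central extension `0 → M → E → R → 0`, where the `R_ab`-module `M` is regarded as a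
bimodule over `R` with equal left and right actions. -/
structure CentralExtension (M : Type u) [AddCommGroup M] [Module ℂ M] [Module (NCAb R) M]
    (E : Type u) [Ring E] [Algebra ℂ E] where
  proj : E →ₐ[ℂ] R
  incl : M →ₗ[ℂ] E
  proj_surjective : Function.Surjective proj
  incl_injective : Function.Injective incl
  exact : ∀ e : E, proj e = 0 ↔ ∃ m : M, incl m = e
  mul_incl : ∀ (e : E) (m : M), e * incl m = incl (NCAb.mk R (proj e) • m)
  incl_mul : ∀ (e : E) (m : M), incl m * e = incl (NCAb.mk R (proj e) • m)

/-- A central extension of `R` by `H₂(R, R_ab)` is universal if its class in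
`H²(R, H₂(R, R_ab))` is the tautological one: for a linear section `s` and the cocycle `c` with
`s(x) s(y) = s(xy) + c(x, y)`, the homomorphism `H₂(R, R_ab) → H₂(R, R_ab)` given by pairing with
`c` is the identity. -/
def CentralExtension.IsUniversal {R : Type u} [Ring R] [Algebra ℂ R]
    {E : Type u} [Ring E] [Algebra ℂ E] (X : CentralExtension R (HochschildH2 R) E) : Prop :=
  ∃ (s : R →ₗ[ℂ] E) (c : R →ₗ[ℂ] R →ₗ[ℂ] HochschildH2 R),
    (∀ x, X.proj (s x) = x) ∧
    (∀ x y, s x * s y = s (x * y) + X.incl (c x y)) ∧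
    ∀ (z : NCAb R ⊗[ℂ] (R ⊗[ℂ] R)) (hz : hochschildBoundaryTwo R z = 0),
      hochschildPairing c z = HochschildH2.mk z hz

end Hochschild

section FiltrationBasics

variable {R : Type u} [Ring R] [Algebra ℂ R]

theorem smul_mem_ncFiltration {d : ℕ} (c : ℂ) {x : R} (hx : x ∈ ncFiltration R d) :
    c • x ∈ ncFiltration R d :=
  (ncFiltrationSubmodule R d).smul_mem c hx

theorem ncFiltration_antitone : Antitone (ncFiltration R) :=
  antitone_nat_of_succ_le (ncFiltration_succ_le R)

theorem ncFiltration_zero : ncFiltration R 0 = ⊤ := by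
  refine top_le_iff.1 fun x _ => ?_
  have h : ncProduct R [] ≤ ncFiltrationSubmodule R 0 :=
    le_iSup (fun l : {l : List ℕ // l.sum = 0} => ncProduct R l.1) ⟨[], rfl⟩
  exact h (by simp [ncProduct])

theorem mem_ncFiltration_zero (x : R) : x ∈ ncFiltration R 0 := by
  rw [ncFiltration_zero]; trivial

theorem lieLower_succ_induction {k : ℕ} {S : Submodule ℂ R}
    (h : ∀ x : R, ∀ y ∈ lieLower R k, x * y - y * x ∈ S) : lieLower R (k + 1) ≤ S := by
  let _ := LieRing.ofAssociativeRing (A := R)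
  rw [lieLower, LieModule.lowerCentralSeries_succ, LieSubmodule.lieIdeal_oper_eq_linear_span',
    Submodule.span_le]
  rintro _ ⟨x, -, y, hy, rfl⟩
  exact h x y hy

theorem commutator_mem_lieLower {k : ℕ} (x : R) {y : R} (hy : y ∈ lieLower R k) :
    x * y - y * x ∈ lieLower R (k + 1) := by
  let _ := LieRing.ofAssociativeRing (A := R)
  have h : ⁅x, y⁆ ∈ LieModule.lowerCentralSeries ℂ R R (k + 1) := by
    rw [LieModule.lowerCentralSeries_succ]
    exact LieSubmodule.lie_mem_lie (LieSubmodule.mem_top x) hy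
  exact h

theorem ncProduct_append (l l' : List ℕ) :
    ncProduct R (l ++ l') = ncProduct R l * ncProduct R l' := by
  rw [ncProduct, ncProduct, ncProduct, List.map_append, List.prod_append, ← mul_assoc]
  induction l using List.reverseRecOn with
  | nil => simp [← mul_assoc, top_mul_top]
  | append_singleton l k _ => simp [mul_assoc, ← mul_assoc (⊤ : Submodule ℂ R) ⊤, top_mul_top]

theorem ncProduct_append_singleton (l : List ℕ) (k : ℕ) :
    ncProduct R (l ++ [k]) = ncProduct R l * lieLower R k * ⊤ := by
  simp [ncProduct, mul_assoc]

theorem ncProduct_le_ncFiltrationSubmodule (l : List ℕ) :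
    ncProduct R l ≤ ncFiltrationSubmodule R l.sum :=
  le_iSup (fun l' : {l' : List ℕ // l'.sum = l.sum} => ncProduct R l'.1) ⟨l, rfl⟩

/-- The NC-filtration is the smallest multiplicative filtration such that bracketing with an
arbitrary element raises the degree by one. -/
theorem ncFiltration_le_of_filtration (G : ℕ → Submodule ℂ R) (h0 : G 0 = ⊤)
    (hmul : ∀ i j, ∀ x ∈ G i, ∀ y ∈ G j, x * y ∈ G (i + j))
    (hcomm : ∀ i, ∀ x, ∀ y ∈ G i, x * y - y * x ∈ G (i + 1)) {d : ℕ} {x : R}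
    (hx : x ∈ ncFiltration R d) : x ∈ G d := by
  have hL : ∀ k, lieLower R k ≤ G k := by
    intro k
    induction k with
    | zero => simp [h0]
    | succ k ih => exact lieLower_succ_induction fun x y hy => hcomm k x y (ih hy)
  have hP : ∀ l : List ℕ, ncProduct R l ≤ G l.sum := by
    intro l
    induction l using List.reverseRecOn with
    | nil => simp [h0]
    | append_singleton l k ih =>
      rw [ncProduct_append_singleton, List.sum_append, List.sum_singleton]
      refine Submodule.mul_le.2 fun y hy z _ => ?_
      have hy' : y ∈ G (l.sum + k) :=
        (Submodule.mul_le.2 fun a ha b hb => hmul _ _ a (ih ha) b (hL k hb)) hy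
      exact hmul (l.sum + k) 0 y hy' z (by simp [h0])
  have : ncFiltrationSubmodule R d ≤ G d := iSup_le fun l => by
    obtain ⟨l, rfl⟩ := l
    exact hP l
  exact this hx

theorem mul_mem_ncFiltration {i j : ℕ} {x y : R} (hx : x ∈ ncFiltration R i)
    (hy : y ∈ ncFiltration R j) : x * y ∈ ncFiltration R (i + j) := by
  have h : ncFiltrationSubmodule R i * ncFiltrationSubmodule R j ≤
      ncFiltrationSubmodule R (i + j) := by
    simp only [ncFiltrationSubmodule, Submodule.iSup_mul, Submodule.mul_iSup]
    refine iSup_le fun l => iSup_le fun l' => ?_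
    obtain ⟨l, rfl⟩ := l
    obtain ⟨l', rfl⟩ := l'
    rw [← ncProduct_append, ← List.sum_append]
    exact ncProduct_le_ncFiltrationSubmodule _
  exact h (Submodule.mul_mem_mul hx hy)

theorem lieLower_le_ncFiltration (k : ℕ) {x : R} (hx : x ∈ lieLower R k) :
    x ∈ ncFiltration R k := by
  have h := ncProduct_le_ncFiltrationSubmodule (R := R) [k]
  have h2 : x ∈ ncProduct R [k] := by
    have := Submodule.mul_mem_mul (Submodule.mem_top (x := (1 : R)) (R := ℂ))
      (Submodule.mul_mem_mul hx (Submodule.mem_top (x := (1 : R)) (R := ℂ)))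
    simpa [ncProduct] using this
  rw [List.sum_singleton] at h
  exact h h2

theorem commutator_mem_ncFiltration_succ {i : ℕ} (x : R) {y : R} (hy : y ∈ ncFiltration R i) :
    x * y - y * x ∈ ncFiltration R (i + 1) := by
  suffices H : ∀ l : List ℕ, ∀ y ∈ ncProduct R l,
      x * y - y * x ∈ ncFiltrationSubmodule R (l.sum + 1) by
    let D : R →ₗ[ℂ] R := LinearMap.mulLeft ℂ x - LinearMap.mulRight ℂ x
    have : ncFiltrationSubmodule R i ≤ (ncFiltrationSubmodule R (i + 1)).comap D :=
      iSup_le fun l => by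
        obtain ⟨l, rfl⟩ := l
        exact fun y hy => H l y hy
    exact this hy
  intro l
  let D : R →ₗ[ℂ] R := LinearMap.mulLeft ℂ x - LinearMap.mulRight ℂ x
  change ncProduct R l ≤ (ncFiltrationSubmodule R (l.sum + 1)).comap D
  induction l using List.reverseRecOn with
  | nil => exact fun y _ => commutator_mem_ncFiltration_one R x y
  | append_singleton l k ih =>
    rw [ncProduct_append_singleton, List.sum_append, List.sum_singleton, mul_assoc]
    refine Submodule.mul_le.2 fun p hp z hz => ?_
    revert z
    change lieLower R k * ⊤ ≤
      ((ncFiltrationSubmodule R (l.sum + k + 1)).comap D).comap (LinearMap.mulLeft ℂ p)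
    refine Submodule.mul_le.2 fun a ha b _ => ?_
    have hp' : p ∈ ncFiltration R l.sum := ncProduct_le_ncFiltrationSubmodule l hp
    have ha' := lieLower_le_ncFiltration k ha
    have e : D (p * (a * b)) = (x * p - p * x) * (a * b) + p * ((x * a - a * x) * b)
        + p * a * (x * b - b * x) := by
      simp only [D, LinearMap.sub_apply, LinearMap.mulLeft_apply, LinearMap.mulRight_apply]
      noncomm_ring
    change D (p * (a * b)) ∈ ncFiltration R (l.sum + k + 1)
    rw [e]
    refine add_mem (add_mem ?_ ?_) ?_
    · have := mul_mem_ncFiltration (show x * p - p * x ∈ ncFiltration R _ from ih hp)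
        (Ideal.mul_mem_right b _ ha')
      convert this using 2
      omega
    · rw [add_assoc]
      exact mul_mem_ncFiltration hp' (Ideal.mul_mem_right b _
        (lieLower_le_ncFiltration _ (commutator_mem_lieLower x ha)))
    · exact mul_mem_ncFiltration (mul_mem_ncFiltration hp' ha')
        (commutator_mem_ncFiltration_one R x b)

theorem mem_ncFiltrationSubmodule {d : ℕ} {x : R} :
    x ∈ ncFiltrationSubmodule R d ↔ x ∈ ncFiltration R d := Iff.rfl

theorem commutator_mem_ncFiltration_add {i j : ℕ} {x y : R} (hx : x ∈ ncFiltration R i)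
    (hy : y ∈ ncFiltration R j) : x * y - y * x ∈ ncFiltration R (i + j + 1) := by
  let G : ℕ → Submodule ℂ R := fun i =>
    { carrier := {x | x ∈ ncFiltration R i ∧
        ∀ j, ∀ y ∈ ncFiltration R j, x * y - y * x ∈ ncFiltration R (i + j + 1)}
      add_mem' := fun {a b} ha hb => ⟨add_mem ha.1 hb.1, fun j y hy => by
        have := add_mem (ha.2 j y hy) (hb.2 j y hy)
        convert this using 1
        noncomm_ring⟩
      zero_mem' := ⟨zero_mem _, fun j y hy => by simp⟩
      smul_mem' := fun c a ha => ⟨smul_mem_ncFiltration c ha.1, fun j y hy => by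
        have := smul_mem_ncFiltration c (ha.2 j y hy)
        simpa [smul_sub] using this⟩ }
  refine (ncFiltration_le_of_filtration G ?_ ?_ ?_ hx).2 j y hy
  · refine top_le_iff.1 fun x _ => ⟨mem_ncFiltration_zero x, fun j y hy => ?_⟩
    simpa using commutator_mem_ncFiltration_succ x hy
  · rintro i j x ⟨hx, hx'⟩ y ⟨hy, hy'⟩
    refine ⟨mul_mem_ncFiltration hx hy, fun k z hz => ?_⟩
    have e : x * y * z - z * (x * y) = x * (y * z - z * y) + (x * z - z * x) * y := by
      noncomm_ring
    rw [e]
    refine add_mem ?_ ?_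
    · convert mul_mem_ncFiltration hx (hy' k z hz) using 2
      omega
    · convert mul_mem_ncFiltration (hx' k z hz) hy using 2
      omega
  · rintro i r x ⟨hx, hx'⟩
    refine ⟨commutator_mem_ncFiltration_succ r hx, fun k z hz => ?_⟩
    have e : (r * x - x * r) * z - z * (r * x - x * r)
        = (r * (x * z - z * x) - (x * z - z * x) * r)
          - (x * (r * z - z * r) - (r * z - z * r) * x) := by
      noncomm_ring
    rw [e]
    refine sub_mem ?_ ?_
    · convert commutator_mem_ncFiltration_succ r (hx' k z hz) using 2
      omega
    · convert hx' (k + 1) _ (commutator_mem_ncFiltration_succ r hz) using 2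
      omega

theorem map_mem_ncFiltration {S : Type*} [Ring S] [Algebra ℂ S] (f : R →ₐ[ℂ] S) {d : ℕ} {x : R}
    (hx : x ∈ ncFiltration R d) : f x ∈ ncFiltration S d := by
  refine ncFiltration_le_of_filtration
    (fun i => (ncFiltrationSubmodule S i).comap f.toLinearMap) ?_ ?_ ?_ hx
  · exact top_le_iff.1 fun x _ => mem_ncFiltration_zero (f x)
  · intro i j x hx y hy
    simpa [mem_ncFiltrationSubmodule] using mul_mem_ncFiltration (R := S) hx hy
  · intro i x y hy
    simpa [mem_ncFiltrationSubmodule] using commutator_mem_ncFiltration_succ (R := S) (f x) hy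

theorem exists_mem_ncFiltration_of_surjective {S : Type*} [Ring S] [Algebra ℂ S] (f : R →ₐ[ℂ] S)
    (hf : Function.Surjective f) {d : ℕ} {y : S} (hy : y ∈ ncFiltration S d) :
    ∃ x ∈ ncFiltration R d, f x = y := by
  refine ncFiltration_le_of_filtration
    (fun i => (ncFiltrationSubmodule R i).map f.toLinearMap) ?_ ?_ ?_ hy
  · refine top_le_iff.1 fun y _ => ?_
    obtain ⟨x, rfl⟩ := hf y
    exact ⟨x, mem_ncFiltration_zero x, rfl⟩
  · rintro i j _ ⟨x, hx, rfl⟩ _ ⟨y, hy, rfl⟩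
    exact ⟨x * y, mul_mem_ncFiltration hx hy, by simp⟩
  · rintro i y _ ⟨x, hx, rfl⟩
    obtain ⟨y, rfl⟩ := hf y
    exact ⟨_, commutator_mem_ncFiltration_succ y hx, by simp⟩

/-- `F^{n+1}` is the sum of `[R, F^n]` and `F^1 F^n`. -/
theorem ncFiltration_succ_induction {n : ℕ} {S : Submodule ℂ R}
    (hcomm : ∀ x, ∀ u ∈ ncFiltration R n, x * u - u * x ∈ S)
    (hmul : ∀ v ∈ ncFiltration R 1, ∀ u ∈ ncFiltration R n, v * u ∈ S) {x : R}
    (hx : x ∈ ncFiltration R (n + 1)) : x ∈ S := by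
  have hmul' : ∀ u ∈ ncFiltration R n, ∀ v ∈ ncFiltration R 1, u * v ∈ S := fun u hu v hv => by
    have := sub_mem (hmul v hv u hu) (hcomm v u hu)
    simpa using this
  have hL : ∀ k i, i + (k + 1) = n + 1 → ∀ p ∈ ncFiltration R i, ∀ b : R,
      lieLower R (k + 1) ≤ S.comap (LinearMap.mulRight ℂ b ∘ₗ LinearMap.mulLeft ℂ p) := by
    intro k
    induction k with
    | zero =>
      intro i hi p hp b z hz
      obtain rfl : i = n := by omega
      have : p * (z * b) ∈ S :=
        hmul' p hp _ (Ideal.mul_mem_right b _ (lieLower_le_ncFiltration 1 hz))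
      simpa [mul_assoc] using this
    | succ k ih =>
      intro i hi p hp b
      refine lieLower_succ_induction fun x l hl => ?_
      have hl' := lieLower_le_ncFiltration _ hl
      have hpl : p * l ∈ ncFiltration R n := by
        convert mul_mem_ncFiltration hp hl' using 2; omega
      have e : p * (x * l - l * x) * b = (x * (p * l * b) - p * l * b * x)
          - p * l * (x * b - b * x) - (x * p - p * x) * l * b := by
        noncomm_ring
      change p * (x * l - l * x) * b ∈ S
      rw [e]
      refine sub_mem (sub_mem ?_ ?_) ?_
      · exact hcomm x _ (Ideal.mul_mem_right b _ hpl)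
      · exact hmul' _ hpl _ (commutator_mem_ncFiltration_one R x b)
      · exact ih (i + 1) (by omega) _ (commutator_mem_ncFiltration_succ x hp) b hl
  have hP : ∀ l : List ℕ, l.sum = n + 1 → ncProduct R l * ⊤ ≤ S := by
    intro l
    induction l using List.reverseRecOn with
    | nil => intro h; simp at h
    | append_singleton l k ih =>
      intro h
      rw [ncProduct_append_singleton, mul_assoc, top_mul_top]
      rw [List.sum_append, List.sum_singleton] at h
      rcases k with _ | k
      · rw [lieLower_zero, ncProduct_mul_top]
        exact ih h
      · refine Submodule.mul_le.2 fun y hy b _ => ?_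
        have : ncProduct R l * lieLower R (k + 1) ≤ S.comap (LinearMap.mulRight ℂ b) :=
          Submodule.mul_le.2 fun p hp z hz =>
            hL k _ h p (ncProduct_le_ncFiltrationSubmodule l hp) b hz
        exact this hy
  have : ncFiltrationSubmodule R (n + 1) ≤ S := iSup_le fun l => by
    have := hP l.1 l.2
    rwa [ncProduct_mul_top] at this
  exact this hx

end FiltrationBasics

section NilpotentIdeals

variable {R : Type*} [Ring R]

theorem Ideal.isNilpotent_of_le {I J : Ideal R} (h : J ≤ I) (hI : IsNilpotent I) :
    IsNilpotent J := by
  obtain ⟨n, hn⟩ := hI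
  refine ⟨n, le_bot_iff.1 (le_trans ?_ hn.le)⟩
  clear hn
  induction n with
  | zero => rw [Submodule.pow_zero, Submodule.pow_zero]
  | succ n ih =>
    rw [Submodule.pow_succ, Submodule.pow_succ]
    exact Ideal.mul_mono ih h

theorem Ideal.isNilpotent_of_forall_exists {S : Type*} [Ring S] (f : R →+* S)
    (hf : Function.Surjective f) {I : Ideal R} {J : Ideal S}
    (h : ∀ y ∈ J, ∃ x ∈ I, f x = y) (hI : IsNilpotent I) : IsNilpotent J := by
  obtain ⟨n, hn⟩ := hI
  have H : ∀ n, ∀ y ∈ J ^ n, ∃ x ∈ I ^ n, f x = y := by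
    intro n
    induction n with
    | zero =>
      intro y _
      obtain ⟨x, rfl⟩ := hf y
      exact ⟨x, by rw [Submodule.pow_zero, Ideal.one_eq_top]; trivial, rfl⟩
    | succ n ih =>
      intro y hy
      rw [Submodule.pow_succ] at hy ⊢
      refine Submodule.smul_induction_on hy ?_ ?_
      · intro r hr s hs
        obtain ⟨a, ha, rfl⟩ := ih r hr
        obtain ⟨b, hb, rfl⟩ := h s hs
        exact ⟨a * b, Ideal.mul_mem_mul ha hb, by simp⟩
      · rintro _ _ ⟨a, ha, rfl⟩ ⟨b, hb, rfl⟩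
        exact ⟨a + b, add_mem ha hb, by simp⟩
  refine ⟨n, (Submodule.eq_bot_iff _).2 fun y hy => ?_⟩
  obtain ⟨x, hx, rfl⟩ := H n y hy
  rw [hn] at hx
  rw [show x = 0 from hx, map_zero]

end NilpotentIdeals

section NilpotentAlgebras

variable {R : Type u} [Ring R] [Algebra ℂ R]

theorem IsNCNilpotent.eq_zero {d : ℕ} (h : IsNCNilpotent d R) {n : ℕ} (hn : d + 1 ≤ n) {x : R}
    (hx : x ∈ ncFiltration R n) : x = 0 := by
  have := ncFiltration_antitone hn hx
  rw [show ncFiltration R (d + 1) = ⊥ from h] at this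
  exact this

theorem isNCNilpotent_of_forall {d : ℕ} (h : ∀ x ∈ ncFiltration R (d + 1), x = 0) :
    IsNCNilpotent d R :=
  (Submodule.eq_bot_iff _).2 h

theorem IsNCNilpotent.mono {d n : ℕ} (h : IsNCNilpotent d R) (hn : d ≤ n) : IsNCNilpotent n R :=
  isNCNilpotent_of_forall fun _ hx => h.eq_zero (Nat.succ_le_succ hn) hx

theorem isNCNilpotent_of_commute (h : ∀ x y : R, x * y = y * x) (d : ℕ) : IsNCNilpotent d R := by
  refine IsNCNilpotent.mono (d := 0) (isNCNilpotent_of_forall fun x hx => ?_) (Nat.zero_le d)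
  refine ncFiltration_le_of_filtration (d := 1) (fun i => if i = 0 then ⊤ else ⊥) rfl ?_ ?_ hx
  · rintro (_ | i) (_ | j) x hx y hy <;> simp_all
  · intro i x y _
    simp [h x y]

theorem commute_of_isNCNilpotent_zero (h : IsNCNilpotent 0 R) (x y : R) : x * y = y * x :=
  sub_eq_zero.1 (h.eq_zero le_rfl (commutator_mem_ncFiltration_one R x y))

theorem isNCNilpotent_of_commRing (A : Type u) [CommRing A] [Algebra ℂ A] (d : ℕ) :
    IsNCNilpotent d A :=
  isNCNilpotent_of_commute mul_comm d

theorem IsNCNilpotent.of_surjective {S : Type u} [Ring S] [Algebra ℂ S] {d : ℕ}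
    (h : IsNCNilpotent d R) (f : R →ₐ[ℂ] S) (hf : Function.Surjective f) : IsNCNilpotent d S :=
  isNCNilpotent_of_forall fun y hy => by
    obtain ⟨x, hx, rfl⟩ := exists_mem_ncFiltration_of_surjective f hf hy
    rw [h.eq_zero le_rfl hx, map_zero]

theorem isNCNilpotent_quotient (d : ℕ) : IsNCNilpotent d (R ⧸ ncFiltration R (d + 1)) :=
  isNCNilpotent_of_forall fun y hy => by
    obtain ⟨x, hx, rfl⟩ := exists_mem_ncFiltration_of_surjective
      (Ideal.Quotient.mkₐ ℂ (ncFiltration R (d + 1))) (Ideal.Quotient.mkₐ_surjective _ _) hy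
    exact Ideal.Quotient.eq_zero_iff_mem.2 hx

theorem IsNCNilpotent.map_eq_zero {S : Type*} [Ring S] [Algebra ℂ S] {d : ℕ}
    (h : IsNCNilpotent d S) (f : R →ₐ[ℂ] S) {x : R} (hx : x ∈ ncFiltration R (d + 1)) :
    f x = 0 :=
  h.eq_zero le_rfl (map_mem_ncFiltration f hx)

theorem ncFiltration_pow_le (n m : ℕ) : ncFiltration R n ^ m ≤ ncFiltration R (m * n) := by
  induction m with
  | zero => simp [ncFiltration_zero]
  | succ m ih =>
    rw [Submodule.pow_succ, add_mul, one_mul]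
    exact Ideal.mul_le.2 fun r hr s hs => mul_mem_ncFiltration (ih hr) hs

theorem IsNCNilpotent.isNilpotent_ncFiltration {d : ℕ} (h : IsNCNilpotent d R) {n : ℕ}
    (hn : 1 ≤ n) : IsNilpotent (ncFiltration R n) := by
  refine ⟨d + 1, ?_⟩
  refine (Submodule.eq_bot_iff _).2 fun x hx => h.eq_zero ?_ (ncFiltration_pow_le n (d + 1) hx)
  exact Nat.le_mul_of_pos_right _ hn

end NilpotentAlgebras

section Commutativization

variable {R : Type u} [Ring R] [Algebra ℂ R]

theorem NCAb.mk_surjective : Function.Surjective (NCAb.mk R) :=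
  Ideal.Quotient.mk_surjective (I := ncFiltration R 1)

theorem NCAb.mk_eq_zero {x : R} : NCAb.mk R x = 0 ↔ x ∈ ncFiltration R 1 :=
  Ideal.Quotient.eq_zero_iff_mem (I := ncFiltration R 1)

theorem NCAb.mk_eq_mk {x y : R} : NCAb.mk R x = NCAb.mk R y ↔ x - y ∈ ncFiltration R 1 := by
  rw [← NCAb.mk_eq_zero, map_sub, sub_eq_zero]

/-- The universal property of the commutativization. -/
def NCAb.lift {B : Type*} [Ring B] [Algebra ℂ B] (hB : IsNCNilpotent 0 B) (f : R →ₐ[ℂ] B) :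
    NCAb R →ₐ[ℂ] B :=
  Ideal.Quotient.liftₐ (ncFiltration R 1) f fun _ hx => hB.map_eq_zero f hx

theorem isNCNilpotent_ncAb (d : ℕ) : IsNCNilpotent d (NCAb R) :=
  isNCNilpotent_of_commRing _ d

/-- A surjection whose kernel lies in `F¹` induces an isomorphism of the commutativizations. -/
theorem exists_ncAb_equiv_of_surjective {S : Type u} [Ring S] [Algebra ℂ S] (f : R →ₐ[ℂ] S)
    (hf : Function.Surjective f) (h : ∀ x, f x = 0 → x ∈ ncFiltration R 1) :
    ∃ ψ : NCAb R ≃ₐ[ℂ] NCAb S, ∀ x : R, ψ (NCAb.mk R x) = NCAb.mk S (f x) := by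
  let ψ : NCAb R →ₐ[ℂ] NCAb S := NCAb.lift (isNCNilpotent_ncAb 0) ((NCAb.mk S).comp f)
  refine ⟨AlgEquiv.ofBijective ψ ⟨(injective_iff_map_eq_zero ψ).2 fun y hy => ?_, fun y => ?_⟩,
    fun x => rfl⟩
  · obtain ⟨x, rfl⟩ := NCAb.mk_surjective y
    have hx : f x ∈ ncFiltration S 1 := NCAb.mk_eq_zero.1 hy
    obtain ⟨z, hz, hzx⟩ := exists_mem_ncFiltration_of_surjective f hf hx
    have := add_mem (h (x - z) (by rw [map_sub, hzx, sub_self])) hz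
    rw [sub_add_cancel] at this
    exact NCAb.mk_eq_zero.2 this
  · obtain ⟨x, rfl⟩ := NCAb.mk_surjective y
    obtain ⟨e, rfl⟩ := hf x
    exact ⟨NCAb.mk R e, rfl⟩

/-- If a subset generates `R` modulo `F¹R`, and `R` is NC-nilpotent, then it generates `R`. -/
theorem IsNCNilpotent.eq_top_of_forall {d : ℕ} (h : IsNCNilpotent d R) (B : Subalgebra ℂ R)
    (hB : ∀ x : R, ∃ b ∈ B, x - b ∈ ncFiltration R 1) : B = ⊤ := by
  let G : ℕ → Submodule ℂ R := fun n =>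
    { carrier := {x | ∃ b ∈ B, b ∈ ncFiltration R n ∧ x - b ∈ ncFiltration R (n + 1)}
      add_mem' := by
        rintro x y ⟨b, hb, hb', hx⟩ ⟨c, hc, hc', hy⟩
        refine ⟨b + c, add_mem hb hc, add_mem hb' hc', ?_⟩
        convert add_mem hx hy using 1
        abel
      zero_mem' := ⟨0, zero_mem _, zero_mem _, by simp⟩
      smul_mem' := by
        rintro c x ⟨b, hb, hb', hx⟩
        refine ⟨c • b, B.smul_mem hb c, smul_mem_ncFiltration c hb', ?_⟩
        rw [← smul_sub]
        exact smul_mem_ncFiltration c hx }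
  have key : ∀ n x, x ∈ ncFiltration R n → x ∈ G n := by
    intro n x hx
    refine ncFiltration_le_of_filtration G ?_ ?_ ?_ hx
    · refine top_le_iff.1 fun x _ => ?_
      obtain ⟨b, hb, hx⟩ := hB x
      exact ⟨b, hb, mem_ncFiltration_zero b, hx⟩
    · rintro i j x ⟨b, hb, hb', hx⟩ y ⟨c, hc, hc', hy⟩
      refine ⟨b * c, mul_mem hb hc, mul_mem_ncFiltration hb' hc', ?_⟩
      have hy' : y ∈ ncFiltration R j := by
        have := add_mem (ncFiltration_antitone (Nat.le_succ j) hy) hc'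
        simpa using this
      have e : x * y - b * c = (x - b) * y + b * (y - c) := by noncomm_ring
      rw [e]
      refine add_mem ?_ (by rw [add_assoc]; exact mul_mem_ncFiltration hb' hy)
      convert mul_mem_ncFiltration hx hy' using 2
      omega
    · rintro i r x ⟨b, hb, hb', hx⟩
      obtain ⟨a, ha, hr⟩ := hB r
      refine ⟨a * b - b * a, sub_mem (mul_mem ha hb) (mul_mem hb ha),
        commutator_mem_ncFiltration_succ a hb', ?_⟩
      have e : r * x - x * r - (a * b - b * a) = (r * (x - b) - (x - b) * r)
        + ((r - a) * b - b * (r - a)) := by noncomm_ring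
      rw [e]
      refine add_mem (commutator_mem_ncFiltration_succ r hx) ?_
      convert commutator_mem_ncFiltration_add hr hb' using 2
      omega
  have H : ∀ n x, ∃ b ∈ B, x - b ∈ ncFiltration R n := by
    intro n
    induction n with
    | zero => exact fun x => ⟨0, zero_mem _, mem_ncFiltration_zero _⟩
    | succ n ih =>
      intro x
      obtain ⟨b, hb, hx⟩ := ih x
      obtain ⟨c, hc, -, hy⟩ := key n _ hx
      exact ⟨b + c, add_mem hb hc, by rwa [← sub_sub]⟩
  refine top_le_iff.1 fun x _ => ?_
  obtain ⟨b, hb, hx⟩ := H (d + 1) x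
  rw [sub_eq_zero.1 (h.eq_zero le_rfl hx)]
  exact hb

/-- NC-nilpotent algebras with finitely generated commutativization are finitely generated, by
any lifts of generators. -/
theorem IsNCNilpotent.finiteType {d : ℕ} (h : IsNCNilpotent d R)
    (hab : Algebra.FiniteType ℂ (NCAb R)) : Algebra.FiniteType ℂ R := by
  classical
  obtain ⟨s, hs⟩ := hab.out
  choose l hl using NCAb.mk_surjective (R := R)
  refine ⟨⟨s.image l, h.eq_top_of_forall _ fun x => ?_⟩⟩
  have hx : NCAb.mk R x ∈ (Algebra.adjoin ℂ ((s.image l : Finset R) : Set R)).map (NCAb.mk R) := by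
    rw [AlgHom.map_adjoin, Finset.coe_image, ← Set.image_comp]
    have : (NCAb.mk R ∘ l) '' (s : Set (NCAb R)) = s := by
      simp [Set.image_congr fun y _ => hl y]
    rw [this, hs]
    trivial
  obtain ⟨b, hb, hbx⟩ := hx
  exact ⟨b, hb, NCAb.mk_eq_mk.1 hbx.symm⟩

end Commutativization

section SmoothBasics

variable {R : Type u} [Ring R] [Algebra ℂ R]

theorem IsDSmooth.of_equiv {d : ℕ} {S : Type u} [Ring S] [Algebra ℂ S] (e : R ≃ₐ[ℂ] S)
    (h : IsDSmooth d R) : IsDSmooth d S where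
  finiteType := h.finiteType.equiv e
  ncNilpotent := h.ncNilpotent.of_surjective e.toAlgHom e.surjective
  formallySmooth := fun Λ' Λ _ _ _ _ hΛ' hΛ p hp hk f => by
    obtain ⟨g, hg⟩ := h.formallySmooth Λ' Λ hΛ' hΛ p hp hk (f.comp e.toAlgHom)
    refine ⟨g.comp e.symm.toAlgHom, ?_⟩
    rw [← AlgHom.comp_assoc, hg]
    ext x
    simp

theorem IsDSmooth.quotient {d n : ℕ} (hn : n ≤ d) (h : IsDSmooth d R) :
    IsDSmooth n (R ⧸ ncFiltration R (n + 1)) where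
  finiteType :=
    haveI := h.finiteType
    Algebra.FiniteType.of_surjective (Ideal.Quotient.mkₐ ℂ _) (Ideal.Quotient.mkₐ_surjective _ _)
  ncNilpotent := isNCNilpotent_quotient n
  formallySmooth := fun Λ' Λ _ _ _ _ hΛ' hΛ p hp hk f => by
    obtain ⟨g, hg⟩ := h.formallySmooth Λ' Λ (hΛ'.mono hn) (hΛ.mono hn) p hp hk
      (f.comp (Ideal.Quotient.mkₐ ℂ _))
    refine ⟨Ideal.Quotient.liftₐ _ g fun a ha => hΛ'.map_eq_zero g ha, ?_⟩
    apply Ideal.Quotient.algHom_ext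
    rw [AlgHom.comp_assoc, Ideal.Quotient.liftₐ_comp, hg]

theorem IsDSmooth.of_smooth (A : Type u) [CommRing A] [Algebra ℂ A] [Algebra.Smooth ℂ A] :
    IsDSmooth 0 A where
  finiteType := inferInstance
  ncNilpotent := isNCNilpotent_of_commRing A 0
  formallySmooth := fun Λ' Λ _ _ _ _ hΛ' hΛ p hp hk f => by
    let _ : CommRing Λ' := { mul_comm := commute_of_isNCNilpotent_zero hΛ' }
    let _ : CommRing Λ := { mul_comm := commute_of_isNCNilpotent_zero hΛ }
    exact ⟨Algebra.FormallySmooth.liftOfSurjective f p hp hk,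
      Algebra.FormallySmooth.comp_liftOfSurjective f p hp hk⟩

theorem isNilpotent_ker_of_le {S : Type*} [Ring S] [Algebra ℂ S] {d : ℕ} (h : IsNCNilpotent d R)
    (p : R →ₐ[ℂ] S) (hp : ∀ x, p x = 0 → x ∈ ncFiltration R 1) :
    IsNilpotent (RingHom.ker p) :=
  Ideal.isNilpotent_of_le (I := ncFiltration R 1) (fun x hx => hp x hx)
    (h.isNilpotent_ncFiltration le_rfl)

end SmoothBasics

section CompleteFiltration

variable (R : Type u) [Ring R] [Algebra ℂ R]

/-- The NC-filtration is separated and every series whose terms go to zero converges. -/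
structure HasConvergentSeries : Prop where
  eq_zero : ∀ x : R, (∀ n, x ∈ ncFiltration R n) → x = 0
  exists_sum : ∀ w : ℕ → R, (∀ n, w n ∈ ncFiltration R n) →
    ∃ x, ∀ n, x - ∑ i ∈ Finset.range n, w i ∈ ncFiltration R n

variable {R}

theorem IsNCNilpotent.hasConvergentSeries {d : ℕ} (h : IsNCNilpotent d R) :
    HasConvergentSeries R where
  eq_zero := fun _ hx => h.eq_zero le_rfl (hx (d + 1))
  exists_sum := fun w hw => by
    refine ⟨∑ i ∈ Finset.range (d + 1), w i, fun n => ?_⟩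
    rcases le_total n (d + 1) with hn | hn
    · rw [← Finset.sum_Ico_eq_sub _ hn]
      exact sum_mem fun i hi => ncFiltration_antitone (Finset.mem_Ico.1 hi).1 (hw i)
    · rw [← neg_sub, neg_mem_iff, ← Finset.sum_Ico_eq_sub _ hn]
      refine sum_mem fun i hi => ?_
      rw [h.eq_zero (Finset.mem_Ico.1 hi).1 (hw i)]
      exact zero_mem _

theorem IsNCComplete.hasConvergentSeries (h : IsNCComplete R) : HasConvergentSeries R where
  eq_zero := fun x hx => by
    refine h.1 (Subtype.ext (funext fun d => ?_))
    have e : Ideal.Quotient.mk (ncFiltration R d) x = 0 := Ideal.Quotient.eq_zero_iff_mem.2 (hx d)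
    exact e.trans (map_zero (Ideal.Quotient.mk (ncFiltration R d))).symm
  exists_sum := fun w hw => by
    let y : NCCompletion R := ⟨fun d => Ideal.Quotient.mk _ (∑ i ∈ Finset.range d, w i), fun d => by
      refine Ideal.Quotient.eq.2 ?_
      rw [Finset.sum_range_succ, add_sub_cancel_left]
      exact hw d⟩
    obtain ⟨x, hx⟩ := h.2 y
    refine ⟨x, fun n => Ideal.Quotient.eq.1 ?_⟩
    exact congrFun (congrArg Subtype.val hx) n

theorem sub_mem_ncFiltration_succ (e : R →ₐ[ℂ] R) (he : ∀ x, e x - x ∈ ncFiltration R 1)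
    {n : ℕ} {x : R} (hx : x ∈ ncFiltration R n) : e x - x ∈ ncFiltration R (n + 1) := by
  let D : R →ₗ[ℂ] R := e.toLinearMap - LinearMap.id
  refine (ncFiltration_le_of_filtration (fun i => ncFiltrationSubmodule R i ⊓
    (ncFiltrationSubmodule R (i + 1)).comap D) ?_ ?_ ?_ hx).2
  · exact top_le_iff.1 fun x _ => ⟨mem_ncFiltration_zero x, he x⟩
  · rintro i j x ⟨hx, hx'⟩ y ⟨hy, hy'⟩
    refine ⟨mul_mem_ncFiltration hx hy, ?_⟩
    replace hx' : e x - x ∈ ncFiltration R (i + 1) := hx'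
    replace hy' : e y - y ∈ ncFiltration R (j + 1) := hy'
    change e (x * y) - x * y ∈ ncFiltration R (i + j + 1)
    have h : e (x * y) - x * y = (e x - x) * e y + x * (e y - y) := by
      rw [map_mul]; noncomm_ring
    rw [h]
    refine add_mem ?_ (by rw [add_assoc]; exact mul_mem_ncFiltration hx hy')
    convert mul_mem_ncFiltration hx' (map_mem_ncFiltration e hy) using 2
    omega
  · rintro i r x ⟨hx, hx'⟩
    refine ⟨commutator_mem_ncFiltration_succ r hx, ?_⟩
    replace hx' : e x - x ∈ ncFiltration R (i + 1) := hx'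
    change e (r * x - x * r) - (r * x - x * r) ∈ ncFiltration R (i + 1 + 1)
    have h : e (r * x - x * r) - (r * x - x * r)
        = ((e r - r) * e x - e x * (e r - r)) + (r * (e x - x) - (e x - x) * r) := by
      rw [map_sub, map_mul, map_mul]; noncomm_ring
    rw [h]
    refine add_mem ?_ (commutator_mem_ncFiltration_succ r hx')
    convert commutator_mem_ncFiltration_add (he r) (map_mem_ncFiltration e hx) using 2
    omega

/-- An endomorphism of a complete algebra inducing the identity on the commutativization is
bijective. -/
theorem HasConvergentSeries.bijective_of_sub_mem (h : HasConvergentSeries R) (e : R →ₐ[ℂ] R)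
    (he : ∀ x, e x - x ∈ ncFiltration R 1) : Function.Bijective e := by
  constructor
  · refine (injective_iff_map_eq_zero e).2 fun x hx => h.eq_zero x fun n => ?_
    induction n with
    | zero => exact mem_ncFiltration_zero x
    | succ n ih =>
      have := sub_mem_ncFiltration_succ e he ih
      rwa [hx, zero_sub, neg_mem_iff] at this
  · intro y
    let w : ℕ → R := fun n => (fun x => x - e x)^[n] y
    have hs : ∀ n, w (n + 1) = w n - e (w n) := fun n => Function.iterate_succ_apply' _ _ _
    have hw : ∀ n, w n ∈ ncFiltration R n := by
      intro n
      induction n with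
      | zero => exact mem_ncFiltration_zero _
      | succ n ih =>
        rw [hs, ← neg_sub, neg_mem_iff]
        exact sub_mem_ncFiltration_succ e he ih
    have hsum : ∀ n, e (∑ i ∈ Finset.range n, w i) = y - w n := by
      intro n
      induction n with
      | zero => simp [w]
      | succ n ih =>
        rw [Finset.sum_range_succ, map_add, ih, hs]
        abel
    obtain ⟨x, hx⟩ := h.exists_sum w hw
    refine ⟨x, sub_eq_zero.1 (h.eq_zero _ fun n => ?_)⟩
    have h1 := map_mem_ncFiltration e (hx n)
    rw [map_sub, hsum] at h1
    have := sub_mem h1 (hw n)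
    convert this using 1
    abel

end CompleteFiltration

section Uniqueness

variable {A : Type u} [CommRing A] [Algebra ℂ A]
variable {R R' : Type u} [Ring R] [Algebra ℂ R] [Ring R'] [Algebra ℂ R']

/-- Homomorphisms in both directions compatible with isomorphisms of the commutativizations are
isomorphisms. -/
theorem HasConvergentSeries.exists_algEquiv (hR : HasConvergentSeries R)
    (hR' : HasConvergentSeries R') (i : NCAb R ≃ₐ[ℂ] A) (i' : NCAb R' ≃ₐ[ℂ] A)
    (φ : R →ₐ[ℂ] R') (ψ : R' →ₐ[ℂ] R)
    (hφ : ∀ x, i' (NCAb.mk R' (φ x)) = i (NCAb.mk R x))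
    (hψ : ∀ x, i (NCAb.mk R (ψ x)) = i' (NCAb.mk R' x)) :
    ∃ e : R ≃ₐ[ℂ] R', ∀ x, i' (NCAb.mk R' (e x)) = i (NCAb.mk R x) := by
  have h1 := hR.bijective_of_sub_mem (ψ.comp φ) fun x =>
    NCAb.mk_eq_mk.1 (i.injective ((hψ _).trans (hφ x)))
  have h2 := hR'.bijective_of_sub_mem (φ.comp ψ) fun x =>
    NCAb.mk_eq_mk.1 (i'.injective ((hφ _).trans (hψ x)))
  have hb : Function.Bijective φ :=
    ⟨fun a b hab => h1.1 (by simp [hab]), fun y => by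
      obtain ⟨x, hx⟩ := h2.2 y
      exact ⟨ψ x, hx⟩⟩
  exact ⟨AlgEquiv.ofBijective φ hb, hφ⟩

theorem IsDSmooth.exists_algHom {d : ℕ} (hR : IsDSmooth d R) (hR' : IsNCNilpotent d R')
    (i : NCAb R ≃ₐ[ℂ] A) (i' : NCAb R' ≃ₐ[ℂ] A) :
    ∃ φ : R →ₐ[ℂ] R', ∀ x, i' (NCAb.mk R' (φ x)) = i (NCAb.mk R x) := by
  obtain ⟨φ, hφ⟩ := hR.formallySmooth R' (NCAb R') hR' (isNCNilpotent_ncAb d) (NCAb.mk R')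
    NCAb.mk_surjective (isNilpotent_ker_of_le hR' _ fun x hx => NCAb.mk_eq_zero.1 hx)
    ((i.trans i'.symm).toAlgHom.comp (NCAb.mk R))
  refine ⟨φ, fun x => ?_⟩
  have := DFunLike.congr_fun hφ x
  rw [AlgHom.comp_apply] at this
  rw [this]
  simp

theorem DSmoothThickening.exists_algEquiv {d : ℕ} (T : DSmoothThickening d A R)
    (T' : DSmoothThickening d A R') :
    ∃ φ : R ≃ₐ[ℂ] R', ∀ x : R, T'.iso (NCAb.mk R' (φ x)) = T.iso (NCAb.mk R x) := by
  obtain ⟨φ, hφ⟩ := T.dSmooth.exists_algHom T'.dSmooth.ncNilpotent T.iso T'.iso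
  obtain ⟨ψ, hψ⟩ := T'.dSmooth.exists_algHom T.dSmooth.ncNilpotent T'.iso T.iso
  exact T.dSmooth.ncNilpotent.hasConvergentSeries.exists_algEquiv
    T'.dSmooth.ncNilpotent.hasConvergentSeries _ _ φ ψ hφ hψ

theorem IsNCSmooth.exists_lift_succ (hR : IsNCSmooth R) (d : ℕ)
    (f : R →ₐ[ℂ] R' ⧸ ncFiltration R' (d + 1)) :
    ∃ g : R →ₐ[ℂ] R' ⧸ ncFiltration R' (d + 2),
      ∀ x, Ideal.Quotient.factorₐ ℂ (ncFiltration_succ_le R' (d + 1)) (g x) = f x := by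
  have hN : IsNCNilpotent (d + 1) (R' ⧸ ncFiltration R' (d + 1)) :=
    (isNCNilpotent_quotient d).mono (Nat.le_succ d)
  obtain ⟨g, hg⟩ := (hR.quotient_dSmooth (d + 1)).formallySmooth _ _ (isNCNilpotent_quotient _) hN
    (Ideal.Quotient.factorₐ ℂ (ncFiltration_succ_le R' (d + 1)))
    (Ideal.Quotient.factor_surjective (ncFiltration_succ_le R' (d + 1)))
    (isNilpotent_ker_of_le (isNCNilpotent_quotient (d + 1)) _ fun x hx => by
      obtain ⟨x, rfl⟩ := Ideal.Quotient.mk_surjective x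
      have hx' : x ∈ ncFiltration R' (d + 1) := Ideal.Quotient.eq_zero_iff_mem.1 hx
      exact map_mem_ncFiltration (Ideal.Quotient.mkₐ ℂ _)
        (ncFiltration_antitone (Nat.le_add_left 1 d) hx'))
    (Ideal.Quotient.liftₐ _ f fun x hx => hN.map_eq_zero f hx)
  exact ⟨g.comp (Ideal.Quotient.mkₐ ℂ _), fun x => DFunLike.congr_fun hg (Ideal.Quotient.mk _ x)⟩

theorem IsNCSmooth.exists_algHom (hR : IsNCSmooth R) (hR' : IsNCComplete R')
    (i : NCAb R ≃ₐ[ℂ] A) (i' : NCAb R' ≃ₐ[ℂ] A) :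
    ∃ φ : R →ₐ[ℂ] R', ∀ x, i' (NCAb.mk R' (φ x)) = i (NCAb.mk R x) := by
  choose next hnext using hR.exists_lift_succ (R' := R')
  let f₀ : R →ₐ[ℂ] R' ⧸ ncFiltration R' (0 + 1) := (i.trans i'.symm).toAlgHom.comp (NCAb.mk R)
  let f : ∀ d, R →ₐ[ℂ] R' ⧸ ncFiltration R' (d + 1) := fun d => Nat.rec f₀ next d
  let h : ∀ d, R →ₐ[ℂ] R' ⧸ ncFiltration R' d := fun d =>
    (Ideal.Quotient.factorₐ ℂ (ncFiltration_succ_le R' d)).comp (f d)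
  have hh : ∀ d x, h (d + 1) x = f d x := fun d x => hnext d (f d) x
  let F : R →ₐ[ℂ] NCCompletion R' := (AlgHom.pi h).codRestrict _ fun x d => by
    change Ideal.Quotient.factorₐ ℂ _ (h (d + 1) x) = h d x
    rw [hh]
    rfl
  let e := AlgEquiv.ofBijective (toNCCompletion R') hR'
  refine ⟨e.symm.toAlgHom.comp F, fun x => ?_⟩
  have h1 : e (e.symm (F x)) = F x := e.apply_symm_apply _
  have h2 : NCAb.mk R' (e.symm (F x)) = h 1 x := congrFun (congrArg Subtype.val h1) 1
  have h3 : NCAb.mk R' (e.symm (F x)) = i'.symm (i (NCAb.mk R x)) := h2.trans (hh 0 x)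
  change i' (NCAb.mk R' (e.symm (F x))) = _
  rw [h3, AlgEquiv.apply_symm_apply]

theorem NCSmoothThickening.exists_algEquiv (T : NCSmoothThickening A R)
    (T' : NCSmoothThickening A R') :
    ∃ φ : R ≃ₐ[ℂ] R', ∀ x : R, T'.iso (NCAb.mk R' (φ x)) = T.iso (NCAb.mk R x) := by
  obtain ⟨φ, hφ⟩ := T.ncSmooth.exists_algHom T'.ncSmooth.ncComplete T.iso T'.iso
  obtain ⟨ψ, hψ⟩ := T'.ncSmooth.exists_algHom T.ncSmooth.ncComplete T'.iso T.iso
  exact T.ncSmooth.ncComplete.hasConvergentSeries.exists_algEquiv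
    T'.ncSmooth.ncComplete.hasConvergentSeries _ _ φ ψ hφ hψ

end Uniqueness

section Derivations

variable {R : Type u} [Ring R] [Algebra ℂ R]
variable {M M' : Type u} [AddCommGroup M] [Module ℂ M] [Module (NCAb R) M]
  [IsScalarTower ℂ (NCAb R) M] [AddCommGroup M'] [Module ℂ M'] [Module (NCAb R) M']
  [IsScalarTower ℂ (NCAb R) M']

/-- Derivations of a `d`-smooth algebra with values in modules over the commutativization lift
along surjections. -/
theorem IsDSmooth.exists_derivation_lift {d : ℕ} (hR : IsDSmooth d R) (p : M' →ₗ[NCAb R] M)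
    (hp : Function.Surjective p) (δ : R →ₗ[ℂ] M)
    (hδ : ∀ x y, δ (x * y) = NCAb.mk R x • δ y + NCAb.mk R y • δ x) :
    ∃ δ' : R →ₗ[ℂ] M', (∀ x y, δ' (x * y) = NCAb.mk R x • δ' y + NCAb.mk R y • δ' x) ∧
      ∀ x, p (δ' x) = δ x := by
  let _ : Module (NCAb R)ᵐᵒᵖ M := Module.compHom _ ((RingHom.id (NCAb R)).fromOpposite mul_comm)
  let _ : Module (NCAb R)ᵐᵒᵖ M' := Module.compHom _ ((RingHom.id (NCAb R)).fromOpposite mul_comm)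
  have : IsCentralScalar (NCAb R) M := ⟨fun _ _ => rfl⟩
  have : IsCentralScalar (NCAb R) M' := ⟨fun _ _ => rfl⟩
  have hδ1 : δ 1 = 0 := by
    have := hδ 1 1
    simpa using this
  let f : R →ₐ[ℂ] TrivSqZeroExt (NCAb R) M :=
    AlgHom.ofLinearMap
      ((TrivSqZeroExt.inlAlgHom ℂ (NCAb R) M).toLinearMap ∘ₗ (NCAb.mk R).toLinearMap +
        (TrivSqZeroExt.inrHom (NCAb R) M).restrictScalars ℂ ∘ₗ δ)
      (by
        ext <;> simp [hδ1])
      (fun x y => by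
        ext <;> simp [hδ])
  let q : TrivSqZeroExt (NCAb R) M' →ₐ[ℂ] TrivSqZeroExt (NCAb R) M :=
    (TrivSqZeroExt.map p).restrictScalars ℂ
  have hq : Function.Surjective q := fun z => by
    obtain ⟨m, hm⟩ := hp z.snd
    exact ⟨TrivSqZeroExt.inl z.fst + TrivSqZeroExt.inr m, by ext <;> simp [q, hm]⟩
  have hk : IsNilpotent (RingHom.ker q) := by
    refine ⟨2, (Submodule.eq_bot_iff _).2 fun z hz => ?_⟩
    rw [pow_two] at hz
    refine (Ideal.mul_le (K := ⊥)).2 (fun r hr s hs => ?_) hz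
    have hr' : r.fst = 0 := by
      have : (q r).fst = 0 := by rw [(RingHom.mem_ker).1 hr]; rfl
      simpa [q] using this
    have hs' : s.fst = 0 := by
      have : (q s).fst = 0 := by rw [(RingHom.mem_ker).1 hs]; rfl
      simpa [q] using this
    rw [Ideal.mem_bot]
    ext <;> simp [hr', hs']
  obtain ⟨g, hg⟩ := hR.formallySmooth _ _ (isNCNilpotent_of_commRing _ d)
    (isNCNilpotent_of_commRing _ d) q hq hk f
  have hg' : ∀ x, q (g x) = f x := fun x => DFunLike.congr_fun hg x
  have hfst : ∀ x, (g x).fst = NCAb.mk R x := fun x => by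
    have := congrArg TrivSqZeroExt.fst (hg' x)
    simpa [q, f] using this
  have hsnd : ∀ x, p (g x).snd = δ x := fun x => by
    have := congrArg TrivSqZeroExt.snd (hg' x)
    simpa [q, f] using this
  refine ⟨(TrivSqZeroExt.sndHom (NCAb R) M').restrictScalars ℂ ∘ₗ g.toLinearMap,
    fun x y => ?_, hsnd⟩
  simp [hfst]

end Derivations

section Splitting

variable {R : Type u} [Ring R] [Algebra ℂ R]

/-- The cokernel of `C₂(R, R_ab) → C₁(R, R_ab)` corepresents derivations, so it is projective when
`R` is `d`-smooth. -/
theorem IsDSmooth.projective_coker {d : ℕ} (hR : IsDSmooth d R) :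
    Module.Projective (NCAb R)
      ((NCAb R ⊗[ℂ] R) ⧸ LinearMap.range (hochschildBoundaryTwo R)) := by
  refine Module.Projective.of_lifting_property'' fun p hp => ?_
  let B := LinearMap.range (hochschildBoundaryTwo R)
  let δ : R →ₗ[ℂ] (NCAb R ⊗[ℂ] R) ⧸ B :=
    (B.mkQ.restrictScalars ℂ) ∘ₗ TensorProduct.mk ℂ (NCAb R) R 1
  have hδ : ∀ x y, δ (x * y) = NCAb.mk R x • δ y + NCAb.mk R y • δ x := fun x y => by
    have h : B.mkQ (hochschildBoundaryTwo R (1 ⊗ₜ (x ⊗ₜ y))) = 0 :=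
      (Submodule.Quotient.mk_eq_zero _).2 ⟨_, rfl⟩
    rw [hochschildBoundaryTwo_tmul, map_add, map_sub, sub_add_eq_add_sub, sub_eq_zero] at h
    have e : ∀ a z, B.mkQ (a ⊗ₜ z) = a • δ z := fun a z => by
      simp only [δ, LinearMap.comp_apply, LinearMap.restrictScalars_apply, ← map_smul,
        TensorProduct.mk_apply, TensorProduct.smul_tmul', smul_eq_mul, mul_one]
    rw [e, e, e] at h
    simpa using h.symm
  obtain ⟨δ', hδ', hpδ⟩ := hR.exists_derivation_lift p hp δ hδ
  let g : NCAb R ⊗[ℂ] R →ₗ[NCAb R] _ := LinearMap.liftBaseChange (NCAb R) δ'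
  have hg : ∀ w, g (hochschildBoundaryTwo R w) = 0 := by
    suffices h : g ∘ₗ hochschildBoundaryTwo R = 0 from fun w => LinearMap.congr_fun h w
    ext x y
    simp [hochschildBoundaryTwo_tmul, g, hδ']
  refine ⟨B.liftQ g (by rintro _ ⟨w, rfl⟩; exact hg w), ?_⟩
  ext x
  simp [g, hpδ, δ, B]

/-- A partial inverse of the boundary `C₂(R, R_ab) → C₁(R, R_ab)`. -/
theorem IsDSmooth.exists_partial_inverse {d : ℕ} (hR : IsDSmooth d R) :
    ∃ σ : NCAb R ⊗[ℂ] R →ₗ[NCAb R] NCAb R ⊗[ℂ] (R ⊗[ℂ] R),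
      ∀ z, hochschildBoundaryTwo R (σ (hochschildBoundaryTwo R z)) = hochschildBoundaryTwo R z := by
  let B := LinearMap.range (hochschildBoundaryTwo R)
  have := hR.projective_coker
  obtain ⟨r, hr⟩ := Module.projective_lifting_property B.mkQ LinearMap.id B.mkQ_surjective
  have hr' : ∀ q, B.mkQ (r q) = q := fun q => LinearMap.congr_fun hr q
  let π : NCAb R ⊗[ℂ] R →ₗ[NCAb R] B :=
    (LinearMap.id - r ∘ₗ B.mkQ).codRestrict B fun z => by
      rw [← Submodule.Quotient.mk_eq_zero, ← Submodule.mkQ_apply]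
      simp [hr', -Submodule.mkQ_apply]
  have hπ : ∀ b : B, π b = b := fun b => by
    have : B.mkQ b.1 = 0 := (Submodule.Quotient.mk_eq_zero _).2 b.2
    ext
    simp [π, this, -Submodule.mkQ_apply]
  have : Module.Projective (NCAb R) B :=
    Module.Projective.of_split B.subtype π (LinearMap.ext hπ)
  obtain ⟨σ, hσ⟩ := Module.projective_lifting_property (hochschildBoundaryTwo R).rangeRestrict
    LinearMap.id (hochschildBoundaryTwo R).surjective_rangeRestrict
  refine ⟨σ ∘ₗ π, fun z => ?_⟩
  have h1 := hπ ⟨hochschildBoundaryTwo R z, z, rfl⟩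
  have h2 := congrArg Subtype.val (LinearMap.congr_fun hσ ⟨hochschildBoundaryTwo R z, z, rfl⟩)
  rw [LinearMap.comp_apply]
  simp only at h1
  rw [h1]
  exact h2

end Splitting

section CocycleExtension

variable {R : Type u} [Ring R] [Algebra ℂ R]
variable {M : Type u} [AddCommGroup M] [Module ℂ M]

/-- The cocycle condition for a Hochschild 2-cochain with values in a module over `R_ab`. -/
def IsHochschildCocycle [Module (NCAb R) M] (c : R →ₗ[ℂ] R →ₗ[ℂ] M) : Prop :=
  ∀ x y z, NCAb.mk R x • c y z - c (x * y) z + c x (y * z) - NCAb.mk R z • c x y = 0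

/-- The underlying space `R ⊕ M` of the central extension of `R` by `M` defined by a cocycle. -/
@[ext]
structure CocycleExtension (c : R →ₗ[ℂ] R →ₗ[ℂ] M) : Type u where
  /-- The component in `R`. -/
  fst : R
  /-- The component in `M`. -/
  snd : M

namespace CocycleExtension

variable {c : R →ₗ[ℂ] R →ₗ[ℂ] M}

instance : Zero (CocycleExtension c) := ⟨⟨0, 0⟩⟩
instance : Add (CocycleExtension c) := ⟨fun e f => ⟨e.fst + f.fst, e.snd + f.snd⟩⟩
instance : Neg (CocycleExtension c) := ⟨fun e => ⟨-e.fst, -e.snd⟩⟩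
instance : SMul ℂ (CocycleExtension c) := ⟨fun a e => ⟨a • e.fst, a • e.snd⟩⟩
instance : One (CocycleExtension c) := ⟨⟨1, -c 1 1⟩⟩

@[simp] theorem zero_fst : (0 : CocycleExtension c).fst = 0 := rfl
@[simp] theorem zero_snd : (0 : CocycleExtension c).snd = 0 := rfl
@[simp] theorem add_fst (e f : CocycleExtension c) : (e + f).fst = e.fst + f.fst := rfl
@[simp] theorem add_snd (e f : CocycleExtension c) : (e + f).snd = e.snd + f.snd := rfl
@[simp] theorem neg_fst (e : CocycleExtension c) : (-e).fst = -e.fst := rfl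
@[simp] theorem neg_snd (e : CocycleExtension c) : (-e).snd = -e.snd := rfl
@[simp] theorem smul_fst (a : ℂ) (e : CocycleExtension c) : (a • e).fst = a • e.fst := rfl
@[simp] theorem smul_snd (a : ℂ) (e : CocycleExtension c) : (a • e).snd = a • e.snd := rfl
@[simp] theorem one_fst : (1 : CocycleExtension c).fst = 1 := rfl
@[simp] theorem one_snd : (1 : CocycleExtension c).snd = -c 1 1 := rfl

variable [Module (NCAb R) M]

instance : Mul (CocycleExtension c) :=
  ⟨fun e f => ⟨e.fst * f.fst,
    NCAb.mk R e.fst • f.snd + NCAb.mk R f.fst • e.snd + c e.fst f.fst⟩⟩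

@[simp] theorem mul_fst (e f : CocycleExtension c) : (e * f).fst = e.fst * f.fst := rfl
@[simp] theorem mul_snd (e f : CocycleExtension c) : (e * f).snd =
    NCAb.mk R e.fst • f.snd + NCAb.mk R f.fst • e.snd + c e.fst f.fst := rfl

instance : AddCommGroup (CocycleExtension c) where
  add_assoc _ _ _ := by ext <;> simp [add_assoc]
  zero_add _ := by ext <;> simp
  add_zero _ := by ext <;> simp
  neg_add_cancel _ := by ext <;> simp
  add_comm _ _ := by ext <;> simp [add_comm]
  nsmul := nsmulRec
  zsmul := zsmulRec

instance : Module ℂ (CocycleExtension c) where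
  one_smul _ := by ext <;> simp
  mul_smul _ _ _ := by ext <;> simp [mul_smul]
  smul_zero _ := by ext <;> simp
  smul_add _ _ _ := by ext <;> simp
  add_smul _ _ _ := by ext <;> simp [add_smul]
  zero_smul _ := by ext <;> simp

theorem _root_.IsHochschildCocycle.one_left (hc : IsHochschildCocycle c) (x : R) :
    c 1 x = NCAb.mk R x • c 1 1 := by
  have := hc 1 1 x
  simpa [sub_eq_zero] using this

theorem _root_.IsHochschildCocycle.one_right (hc : IsHochschildCocycle c) (x : R) :
    c x 1 = NCAb.mk R x • c 1 1 := by
  have := hc x 1 1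
  simp only [mul_one, map_one, one_smul, sub_add_cancel] at this
  exact (sub_eq_zero.1 this).symm

/-- The ring structure on the extension defined by a cocycle. -/
abbrev ring (hc : IsHochschildCocycle c) : Ring (CocycleExtension c) :=
  { (inferInstance : AddCommGroup (CocycleExtension c)),
    (inferInstance : Mul (CocycleExtension c)), (inferInstance : One (CocycleExtension c)) with
    left_distrib := fun e f g => by
      ext
      · simp [mul_add]
      · simp only [mul_snd, add_snd, add_fst, map_add, smul_add, add_smul]; abel
    right_distrib := fun e f g => by
      ext
      · simp [add_mul]
      · simp only [mul_snd, add_snd, add_fst, map_add, smul_add, add_smul, LinearMap.add_apply]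
        abel
    zero_mul := fun e => by ext <;> simp
    mul_zero := fun e => by ext <;> simp
    mul_assoc := fun e f g => by
      ext
      · simp [mul_assoc]
      · have h := hc e.fst f.fst g.fst
        rw [sub_eq_zero] at h
        simp only [mul_snd, mul_fst, map_mul, smul_add, mul_smul]
        rw [← h, smul_comm (NCAb.mk R g.fst) (NCAb.mk R e.fst) f.snd,
          smul_comm (NCAb.mk R g.fst) (NCAb.mk R f.fst) e.snd]
        abel
    one_mul := fun e => by
      ext
      · simp
      · simp [hc.one_left e.fst]
    mul_one := fun e => by
      ext
      · simp
      · simp [hc.one_right e.fst] }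

variable [IsScalarTower ℂ (NCAb R) M]

/-- The algebra structure on the extension defined by a cocycle. -/
abbrev algebra (hc : IsHochschildCocycle c) :
    @Algebra ℂ (CocycleExtension c) _ (ring hc).toSemiring :=
  letI := ring hc
  Algebra.ofModule
    (fun a e f => by
      ext
      · simp
      · simp [smul_add, smul_comm _ a])
    (fun a e f => by
      ext
      · simp
      · simp [smul_add, smul_comm _ a])

/-- A cocycle defines a central extension. -/
theorem exists_centralExtension (hc : IsHochschildCocycle c) :
    ∃ (E : Type u) (_ : Ring E) (_ : Algebra ℂ E) (X : CentralExtension R M E) (s : R →ₗ[ℂ] E),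
      (∀ x, X.proj (s x) = x) ∧ ∀ x y, s x * s y = s (x * y) + X.incl (c x y) := by
  let _ := ring hc
  let _ := algebra hc
  let pr : CocycleExtension c →ₗ[ℂ] R :=
    { toFun := fst, map_add' := fun _ _ => rfl, map_smul' := fun _ _ => rfl }
  let inc : M →ₗ[ℂ] CocycleExtension c :=
    { toFun := fun m => ⟨0, m⟩
      map_add' := fun _ _ => by ext <;> simp
      map_smul' := fun _ _ => by ext <;> simp }
  let s : R →ₗ[ℂ] CocycleExtension c :=
    { toFun := fun x => ⟨x, 0⟩
      map_add' := fun _ _ => by ext <;> simp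
      map_smul' := fun _ _ => by ext <;> simp }
  refine ⟨CocycleExtension c, ring hc, algebra hc,
    { proj := AlgHom.ofLinearMap pr rfl fun _ _ => rfl
      incl := inc
      proj_surjective := fun x => ⟨⟨x, 0⟩, rfl⟩
      incl_injective := fun m n h => congrArg snd h
      exact := fun e => ⟨fun h => ⟨e.snd, CocycleExtension.ext (Eq.symm h) rfl⟩, ?_⟩
      mul_incl := fun e m => ?_
      incl_mul := fun e m => ?_ }, s, fun x => rfl, fun x y => ?_⟩
  · rintro ⟨m, rfl⟩
    rfl
  · ext <;> simp [inc, pr]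
  · ext <;> simp [inc, pr]
  · ext <;> simp [inc, s]

end CocycleExtension

end CocycleExtension

section UniversalExtension

variable {R : Type u} [Ring R] [Algebra ℂ R]

section Pairing

variable {M : Type u} [AddCommGroup M] [Module ℂ M] [Module (NCAb R) M]
  [IsScalarTower ℂ (NCAb R) M]

@[simp]
theorem hochschildPairing_tmul (c : R →ₗ[ℂ] R →ₗ[ℂ] M) (a : NCAb R) (x y : R) :
    hochschildPairing c (a ⊗ₜ (x ⊗ₜ y)) = a • c x y := by
  simp [hochschildPairing]

theorem IsHochschildCocycle.pairing_boundary {c : R →ₗ[ℂ] R →ₗ[ℂ] M} (hc : IsHochschildCocycle c)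
    (w : NCAb R ⊗[ℂ] (R ⊗[ℂ] (R ⊗[ℂ] R))) :
    hochschildPairing c (hochschildBoundaryThree R w) = 0 := by
  suffices h : hochschildPairing c ∘ₗ hochschildBoundaryThree R = 0 from LinearMap.congr_fun h w
  ext x y z
  have := hc x y z
  simpa [hochschildBoundaryThree_tmul] using this

end Pairing

theorem IsDSmooth.exists_universal {d : ℕ} (hR : IsDSmooth d R) :
    ∃ (E : Type u) (_ : Ring E) (_ : Algebra ℂ E)
      (X : CentralExtension R (HochschildH2 R) E), X.IsUniversal := by
  obtain ⟨σ, hσ⟩ := hR.exists_partial_inverse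
  let B := LinearMap.range (hochschildBoundaryThree R)
  let r : NCAb R ⊗[ℂ] (R ⊗[ℂ] R) →ₗ[NCAb R] HochschildH2 R :=
    (B.mkQ ∘ₗ (LinearMap.id - σ ∘ₗ hochschildBoundaryTwo R)).codRestrict _ fun z =>
      Submodule.mem_map_of_mem (by simp [hσ])
  have hr : ∀ z (hz : hochschildBoundaryTwo R z = 0), r z = HochschildH2.mk z hz := fun z hz =>
    Subtype.ext (by simp [r, HochschildH2.mk, hz, B])
  have hr3 : ∀ w, r (hochschildBoundaryThree R w) = 0 := fun w => by
    rw [hr _ (hochschildBoundaryTwo_boundaryThree R w)]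
    exact Subtype.ext ((Submodule.Quotient.mk_eq_zero _).2 ⟨w, rfl⟩)
  let c : R →ₗ[ℂ] R →ₗ[ℂ] HochschildH2 R :=
    TensorProduct.curry (r.restrictScalars ℂ ∘ₗ TensorProduct.mk ℂ (NCAb R) (R ⊗[ℂ] R) 1)
  have hcr : hochschildPairing c = r := by
    ext x y
    simp [c]
  have hc : IsHochschildCocycle c := fun x y z => by
    have h := hr3 (1 ⊗ₜ (x ⊗ₜ (y ⊗ₜ z)))
    rw [← hcr, hochschildBoundaryThree_tmul] at h
    simpa using h
  obtain ⟨E, i₁, i₂, X, s, hs, hsc⟩ := CocycleExtension.exists_centralExtension hc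
  exact ⟨E, i₁, i₂, X, s, c, hs, hsc, fun z hz => by rw [hcr, hr]⟩

end UniversalExtension

namespace CentralExtension

section Basic

variable {R : Type u} [Ring R] [Algebra ℂ R]
variable {M : Type u} [AddCommGroup M] [Module ℂ M] [Module (NCAb R) M]
variable {E : Type u} [Ring E] [Algebra ℂ E] (X : CentralExtension R M E)

theorem proj_incl (m : M) : X.proj (X.incl m) = 0 := (X.exact _).2 ⟨m, rfl⟩

theorem incl_mul_incl (m n : M) : X.incl m * X.incl n = 0 := by
  rw [X.mul_incl, X.proj_incl, map_zero, zero_smul, map_zero]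

theorem isNilpotent_ker : IsNilpotent (RingHom.ker X.proj) := by
  refine ⟨2, (Submodule.eq_bot_iff _).2 fun z hz => ?_⟩
  rw [show (2 : ℕ) = 1 + 1 from rfl, Submodule.pow_succ, Submodule.pow_one] at hz
  refine (Ideal.mul_le (K := ⊥)).2 (fun r hr s hs => ?_) hz
  obtain ⟨m, rfl⟩ := (X.exact r).1 hr
  obtain ⟨n, rfl⟩ := (X.exact s).1 hs
  exact X.incl_mul_incl m n

/-- A central extension raises the degree of NC-nilpotency at most by one. -/
theorem isNCNilpotent (X : CentralExtension R M E) {d : ℕ} (hR : IsNCNilpotent d R)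
    : IsNCNilpotent (d + 1) E := by
  have hK : ∀ u ∈ ncFiltration E (d + 1), ∃ m, X.incl m = u := fun u hu =>
    (X.exact u).1 (hR.map_eq_zero X.proj hu)
  refine isNCNilpotent_of_forall fun x hx => ?_
  refine ncFiltration_succ_induction (S := ⊥) (fun x u hu => ?_) (fun v hv u hu => ?_) hx
  · obtain ⟨m, rfl⟩ := hK u hu
    rw [Submodule.mem_bot, X.mul_incl, X.incl_mul, sub_self]
  · obtain ⟨m, rfl⟩ := hK u hu
    rw [Submodule.mem_bot, X.mul_incl, NCAb.mk_eq_zero.2 (map_mem_ncFiltration X.proj hv),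
      zero_smul, map_zero]

/-- The coordinate of a central extension in the direction of the kernel, given a linear
section. -/
theorem exists_coordinate (s : R →ₗ[ℂ] E) (hs : ∀ x, X.proj (s x) = x) :
    ∃ η : E →ₗ[ℂ] M, ∀ e, e = s (X.proj e) + X.incl (η e) := by
  obtain ⟨l, hl⟩ := X.incl.exists_leftInverse_of_injective (LinearMap.ker_eq_bot.2 X.incl_injective)
  refine ⟨l ∘ₗ (LinearMap.id - s ∘ₗ X.proj.toLinearMap), fun e => ?_⟩
  obtain ⟨m, hm⟩ := (X.exact (e - s (X.proj e))).1 (by simp [hs])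
  have : l (X.incl m) = m := LinearMap.congr_fun hl m
  rw [LinearMap.comp_apply, LinearMap.sub_apply, LinearMap.id_apply, LinearMap.comp_apply,
    AlgHom.toLinearMap_apply, ← hm, this, hm]
  abel

theorem map_mul_coordinate {s : R →ₗ[ℂ] E} {c : R →ₗ[ℂ] R →ₗ[ℂ] M}
    (hsc : ∀ x y, s x * s y = s (x * y) + X.incl (c x y)) (hs : ∀ x, X.proj (s x) = x)
    {η : E →ₗ[ℂ] M} (hη : ∀ e, e = s (X.proj e) + X.incl (η e)) (e f : E) :
    η (e * f) = c (X.proj e) (X.proj f) + NCAb.mk R (X.proj e) • η f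
      + NCAb.mk R (X.proj f) • η e := by
  apply X.incl_injective
  have h1 : e * f = (s (X.proj e) + X.incl (η e)) * (s (X.proj f) + X.incl (η f)) := by
    rw [← hη, ← hη]
  have h2 := hη (e * f)
  rw [map_mul X.proj, ← sub_eq_iff_eq_add'] at h2
  rw [← h2, h1, add_mul, mul_add, mul_add, hsc, X.mul_incl, X.incl_mul, X.incl_mul_incl, hs, hs,
    map_add, map_add]
  abel

/-- For a central extension of a `d`-smooth algebra, the values of its cocycle on Hochschild cycles
lie in `F^{d+1}`: the induced extension of `R` by the image of `M` in `E / F^{d+1} E` splits. -/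
theorem incl_pairing_mem [IsScalarTower ℂ (NCAb R) M] {d : ℕ} (hR : IsDSmooth d R)
    (s : R →ₗ[ℂ] E) (c : R →ₗ[ℂ] R →ₗ[ℂ] M) (hs : ∀ x, X.proj (s x) = x)
    (hsc : ∀ x y, s x * s y = s (x * y) + X.incl (c x y)) (z : NCAb R ⊗[ℂ] (R ⊗[ℂ] R))
    (hz : hochschildBoundaryTwo R z = 0) :
    X.incl (hochschildPairing c z) ∈ ncFiltration E (d + 1) := by
  let q := Ideal.Quotient.mkₐ ℂ (ncFiltration E (d + 1))
  have hq : Function.Surjective q := Ideal.Quotient.mkₐ_surjective _ _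
  let pr : E ⧸ ncFiltration E (d + 1) →ₐ[ℂ] R :=
    Ideal.Quotient.liftₐ _ X.proj fun x hx => hR.ncNilpotent.map_eq_zero X.proj hx
  have hpr : ∀ e, pr (q e) = X.proj e := fun e => rfl
  have hpr' : Function.Surjective pr := fun x => ⟨q (s x), by rw [hpr, hs]⟩
  have hk : IsNilpotent (RingHom.ker pr) :=
    Ideal.isNilpotent_of_forall_exists q.toRingHom hq (I := RingHom.ker X.proj)
      (fun y hy => by
        obtain ⟨x, rfl⟩ := hq y
        exact ⟨x, hy, rfl⟩) X.isNilpotent_ker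
  obtain ⟨g, hg⟩ := hR.formallySmooth _ _ (isNCNilpotent_quotient d) hR.ncNilpotent pr hpr' hk
    (AlgHom.id ℂ R)
  have hg' : ∀ x, pr (g x) = x := fun x => DFunLike.congr_fun hg x
  have hqmul : ∀ x m, q (X.incl (NCAb.mk R x • m)) = q (s x) * q (X.incl m) := fun x m => by
    rw [← map_mul, X.mul_incl, hs]
  have hqmul' : ∀ x m, q (X.incl (NCAb.mk R x • m)) = q (X.incl m) * q (s x) := fun x m => by
    rw [← map_mul, X.incl_mul, hs]
  let H' : Submodule (NCAb R) M :=
    { carrier := {h | q (X.incl h) = 0}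
      add_mem' := fun {a b} ha hb => by
        change q (X.incl (a + b)) = 0
        rw [map_add, map_add, show q (X.incl a) = 0 from ha, show q (X.incl b) = 0 from hb,
          add_zero]
      zero_mem' := by simp
      smul_mem' := fun r a ha => by
        obtain ⟨x, rfl⟩ := NCAb.mk_surjective r
        change q (X.incl (NCAb.mk R x • a)) = 0
        rw [hqmul, show q (X.incl a) = 0 from ha, mul_zero] }
  have heq : ∀ {a b}, q (X.incl a) = q (X.incl b) → H'.mkQ a = H'.mkQ b := fun {a b} hab => by
    rw [Submodule.mkQ_apply, Submodule.mkQ_apply, Submodule.Quotient.eq]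
    change q (X.incl (a - b)) = 0
    rw [map_sub, map_sub, hab, sub_self]
  have ht : ∀ x, ∃ m, q (X.incl m) = q (s x) - g x := fun x => by
    obtain ⟨e, he⟩ := hq (q (s x) - g x)
    have h0 : X.proj e = 0 := by rw [← hpr, he, map_sub, hpr, hs, hg', sub_self]
    obtain ⟨m, rfl⟩ := (X.exact e).1 h0
    exact ⟨m, he⟩
  choose t ht using ht
  let τ : R →ₗ[ℂ] M ⧸ H' :=
    { toFun := fun x => H'.mkQ (t x)
      map_add' := fun x y => by
        rw [← map_add]
        refine heq ?_
        rw [map_add, map_add, ht, ht, ht, map_add, map_add, map_add]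
        abel
      map_smul' := fun a x => by
        have e : H'.mkQ (a • t x) = a • H'.mkQ (t x) := rfl
        rw [RingHom.id_apply, ← e]
        refine heq ?_
        rw [map_smul, map_smul, ht, ht, map_smul, map_smul, map_smul, smul_sub] }
  have hτ : ∀ x y, H'.mkQ (c x y) = NCAb.mk R x • τ y - τ (x * y) + NCAb.mk R y • τ x := by
    intro x y
    change H'.mkQ (c x y) =
      NCAb.mk R x • H'.mkQ (t y) - H'.mkQ (t (x * y)) + NCAb.mk R y • H'.mkQ (t x)
    rw [← map_smul, ← map_smul, ← map_sub, ← map_add]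
    refine heq ?_
    have h1 : q (X.incl (c x y)) = q (s x) * q (s y) - q (s (x * y)) := by
      rw [← map_mul, hsc, map_add]
      abel
    have h2 : (q (s x) - g x) * (q (s y) - g y) = 0 := by
      rw [← ht, ← ht, ← map_mul, X.incl_mul_incl, map_zero]
    rw [map_add, map_add, map_sub, map_sub, hqmul, hqmul', ht, ht, ht, h1, map_mul g]
    rw [← sub_eq_zero, ← neg_eq_zero, ← h2]
    noncomm_ring
  have key : H'.mkQ ∘ₗ hochschildPairing c =
      LinearMap.liftBaseChange (NCAb R) τ ∘ₗ hochschildBoundaryTwo R := by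
    ext x y
    simp [hochschildBoundaryTwo_tmul, -Submodule.mkQ_apply, hτ]
  have h0 : H'.mkQ (hochschildPairing c z) = 0 := by
    have := LinearMap.congr_fun key z
    rw [LinearMap.comp_apply, LinearMap.comp_apply, hz, map_zero] at this
    exact this
  have h1 : hochschildPairing c z ∈ H' := (Submodule.Quotient.mk_eq_zero _).1 h0
  exact Ideal.Quotient.eq_zero_iff_mem.1 h1

end Basic

section Universal

variable {R : Type u} [Ring R] [Algebra ℂ R]
variable {E : Type u} [Ring E] [Algebra ℂ E] {X : CentralExtension R (HochschildH2 R) E}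

/-- The kernel of a universal central extension of a `d`-smooth algebra lies in `F^{d+1}`. -/
theorem IsUniversal.incl_mem {d : ℕ} (hR : IsDSmooth d R) (hX : X.IsUniversal)
    (h : HochschildH2 R) : X.incl h ∈ ncFiltration E (d + 1) := by
  obtain ⟨s, c, hs, hsc, hu⟩ := hX
  obtain ⟨_, z, hz, rfl⟩ := h
  have := X.incl_pairing_mem hR s c hs hsc z hz
  rwa [hu z hz] at this

theorem IsUniversal.exists_ncAb_equiv {d : ℕ} (hR : IsDSmooth d R) (hX : X.IsUniversal) :
    ∃ ψ : NCAb E ≃ₐ[ℂ] NCAb R, ∀ x : E, ψ (NCAb.mk E x) = NCAb.mk R (X.proj x) := by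
  refine exists_ncAb_equiv_of_surjective X.proj X.proj_surjective fun x hx => ?_
  obtain ⟨m, rfl⟩ := (X.exact x).1 hx
  exact ncFiltration_antitone (Nat.le_add_left 1 d) (hX.incl_mem hR m)

variable {M : Type u} [AddCommGroup M] [Module ℂ M] [Module (NCAb R) M]
  [IsScalarTower ℂ (NCAb R) M] {Λ : Type u} [Ring Λ] [Algebra ℂ Λ]

/-- A linear map `t : R → Λ` that is multiplicative modulo a central square-zero ideal `M` can be
corrected modulo `M` to a homomorphism from a universal central extension of `R`. -/
theorem IsUniversal.exists_algHom {d : ℕ} (hR : IsDSmooth d R) (hX : X.IsUniversal)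
    (ι : M →ₗ[ℂ] Λ) (hι : Function.Injective ι) (t : R →ₗ[ℂ] Λ)
    (hl : ∀ x m, t x * ι m = ι (NCAb.mk R x • m)) (hr : ∀ x m, ι m * t x = ι (NCAb.mk R x • m))
    (hιι : ∀ m n, ι m * ι n = 0) (ht : ∀ x y, ∃ m, t x * t y - t (x * y) = ι m)
    (ht1 : ∃ m, t 1 - 1 = ι m) :
    ∃ G : E →ₐ[ℂ] Λ, ∀ e, ∃ m, G e - t (X.proj e) = ι m := by
  obtain ⟨s, c, hs, hsc, hu⟩ := hX
  obtain ⟨η, hη⟩ := X.exists_coordinate s hs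
  obtain ⟨σ, hσ⟩ := hR.exists_partial_inverse
  obtain ⟨l, hl'⟩ := ι.exists_leftInverse_of_injective (LinearMap.ker_eq_bot.2 hι)
  let b : R →ₗ[ℂ] R →ₗ[ℂ] M :=
    ((LinearMap.mul ℂ Λ).compl₁₂ t t - (LinearMap.mul ℂ R).compr₂ t).compr₂ l
  have hb : ∀ x y, t x * t y = t (x * y) + ι (b x y) := fun x y => by
    obtain ⟨m, hm⟩ := ht x y
    have h1 : b x y = l (t x * t y - t (x * y)) := by simp [b]
    have h2 : l (ι m) = m := LinearMap.congr_fun hl' m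
    rw [h1, hm, h2, ← hm]
    abel
  have hbc : IsHochschildCocycle b := fun x y z => by
    apply hι
    have h := mul_assoc (t x) (t y) (t z)
    rw [hb, hb, add_mul, mul_add, hr, hl, hb, hb, mul_assoc, add_assoc, add_assoc,
      add_right_inj] at h
    rw [map_sub, map_add, map_sub, map_zero, sub_eq_zero]
    rw [← sub_eq_iff_eq_add'] at h
    rw [← h]
    abel
  let φ : HochschildH2 R →ₗ[NCAb R] M :=
    (LinearMap.range (hochschildBoundaryThree R)).liftQ (hochschildPairing b)
      (by rintro _ ⟨w, rfl⟩; exact hbc.pairing_boundary w) ∘ₗ Submodule.subtype _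
  have hφ : ∀ z hz, φ (HochschildH2.mk z hz) = hochschildPairing b z := fun z hz => rfl
  let β := hochschildPairing b - φ ∘ₗ hochschildPairing c
  have hβ : ∀ z, β z = β (σ (hochschildBoundaryTwo R z)) := fun z => by
    rw [← sub_eq_zero, ← map_sub]
    have hz : hochschildBoundaryTwo R (z - σ (hochschildBoundaryTwo R z)) = 0 := by
      rw [map_sub, hσ, sub_self]
    rw [LinearMap.sub_apply, LinearMap.comp_apply, hu _ hz, hφ, sub_self]
  let τ : R →ₗ[ℂ] M := ((β ∘ₗ σ).restrictScalars ℂ) ∘ₗ TensorProduct.mk ℂ (NCAb R) R 1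
  have hτ : ∀ x y, b x y = φ (c x y) + (NCAb.mk R x • τ y - τ (x * y) + NCAb.mk R y • τ x) := by
    intro x y
    have h1 : β (1 ⊗ₜ (x ⊗ₜ y)) = b x y - φ (c x y) := by simp [β]
    have e : ∀ a z, β (σ (a ⊗ₜ z)) = a • τ z := fun a z => by
      simp only [τ, LinearMap.comp_apply, LinearMap.restrictScalars_apply, ← map_smul,
        TensorProduct.mk_apply, TensorProduct.smul_tmul', smul_eq_mul, mul_one]
    have h2 := hβ (1 ⊗ₜ (x ⊗ₜ y))
    rw [h1, hochschildBoundaryTwo_tmul, map_add, map_add, map_sub, map_sub, e, e, e, one_mul,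
      mul_one, one_smul, sub_eq_iff_eq_add'] at h2
    exact h2
  let G : E →ₗ[ℂ] Λ := (t - ι ∘ₗ τ) ∘ₗ X.proj.toLinearMap + ι ∘ₗ φ.restrictScalars ℂ ∘ₗ η
  have hG : ∀ e, G e = t (X.proj e) + ι (φ (η e) - τ (X.proj e)) := fun e => by
    simp [G]
    abel
  have hGmul : ∀ e f, G (e * f) = G e * G f := fun e f => by
    rw [hG, hG, hG, add_mul, mul_add, mul_add, hl, hr, hιι, hb, X.map_mul_coordinate hsc hs hη,
      hτ, map_mul]
    simp only [map_add, map_sub, map_smul, smul_sub]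
    abel
  have hG1 : G 1 = 1 := by
    obtain ⟨m, hm⟩ := ht1
    have h1 : ∃ n, G 1 = 1 + ι n := ⟨m + (φ (η 1) - τ 1), by
      rw [hG, map_one, map_add, ← hm]
      abel⟩
    obtain ⟨n, hn⟩ := h1
    have h2 := hGmul 1 1
    rw [mul_one, hn, add_mul, mul_add, mul_add, hιι, one_mul, one_mul, mul_one, add_zero] at h2
    rw [hn, left_eq_add.1 h2, add_zero]
  exact ⟨AlgHom.ofLinearMap G hG1 hGmul, fun e => ⟨φ (η e) - τ (X.proj e), by
    rw [AlgHom.ofLinearMap_apply, hG, add_sub_cancel_left]⟩⟩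

end Universal

end CentralExtension

section TopPiece

variable {R : Type u} [Ring R] [Algebra ℂ R] {Λ : Type u} [Ring Λ] [Algebra ℂ Λ]

theorem AlgHom.exists_comp_eq_of_surjective {E S : Type*} [Ring E] [Algebra ℂ E] [Ring S]
    [Algebra ℂ S] (π : E →ₐ[ℂ] R) (hπ : Function.Surjective π) (f : E →ₐ[ℂ] S)
    (h : ∀ e, π e = 0 → f e = 0) : ∃ g : R →ₐ[ℂ] S, ∀ e, g (π e) = f e := by
  refine ⟨(Ideal.Quotient.liftₐ (RingHom.ker π) f fun e he => h e he).comp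
    (Ideal.quotientKerAlgEquivOfSurjective hπ).symm.toAlgHom, fun e => ?_⟩
  have := Ideal.quotientKerAlgEquivOfSurjective_symm_apply hπ e
  rw [AlgHom.comp_apply, AlgEquiv.coe_toAlgHom, this]
  rfl

namespace IsNCNilpotent

variable {d : ℕ}

theorem mul_eq_zero_of_mem (hΛ : IsNCNilpotent (d + 1) Λ) {v m : Λ} (hv : v ∈ ncFiltration Λ 1)
    (hm : m ∈ ncFiltration Λ (d + 1)) : v * m = 0 :=
  hΛ.eq_zero (by omega) (mul_mem_ncFiltration hv hm)

theorem mul_comm_of_mem (hΛ : IsNCNilpotent (d + 1) Λ) {m : Λ} (hm : m ∈ ncFiltration Λ (d + 1))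
    (x : Λ) : x * m = m * x :=
  sub_eq_zero.1 (hΛ.eq_zero le_rfl (commutator_mem_ncFiltration_succ x hm))

theorem mul_eq_zero_of_mem_of_mem (hΛ : IsNCNilpotent (d + 1) Λ) {m n : Λ}
    (hm : m ∈ ncFiltration Λ (d + 1))
    (hn : n ∈ ncFiltration Λ (d + 1)) : m * n = 0 :=
  hΛ.mul_eq_zero_of_mem (ncFiltration_antitone (Nat.le_add_left 1 d) hm) hn

/-- The last term `F^{d+1}` of the NC-filtration, a module over any algebra mapping to the
commutativization. -/
abbrev topModule (hΛ : IsNCNilpotent (d + 1) Λ) (ρ : NCAb R →ₐ[ℂ] NCAb Λ) : Module (NCAb R)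
    (ncFiltration Λ (d + 1)) :=
  letI : Module (NCAb Λ) (ncFiltration Λ (d + 1)) :=
    Module.IsTorsionBySet.module (I := ncFiltration Λ 1) fun m v =>
      Subtype.ext (hΛ.mul_eq_zero_of_mem v.2 m.2)
  Module.compHom _ ρ.toRingHom

theorem topModule_smul (hΛ : IsNCNilpotent (d + 1) Λ) (ρ : NCAb R →ₐ[ℂ] NCAb Λ) {a : NCAb R}
    {v : Λ} (h : ρ a = NCAb.mk Λ v)
    (m : ncFiltration Λ (d + 1)) :
    letI := hΛ.topModule ρ
    ((a • m : ncFiltration Λ (d + 1)) : Λ) = v * m := by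
  let _ : Module (NCAb Λ) (ncFiltration Λ (d + 1)) :=
    Module.IsTorsionBySet.module (I := ncFiltration Λ 1) fun m v =>
      Subtype.ext (hΛ.mul_eq_zero_of_mem v.2 m.2)
  change ((ρ a • m : ncFiltration Λ (d + 1)) : Λ) = v * m
  rw [h]
  rfl

theorem topModule_isScalarTower (hΛ : IsNCNilpotent (d + 1) Λ) (ρ : NCAb R →ₐ[ℂ] NCAb Λ) :
    letI := hΛ.topModule ρ
    IsScalarTower ℂ (NCAb R) (ncFiltration Λ (d + 1)) := by
  let _ := hΛ.topModule ρ
  refine ⟨fun c a m => ?_⟩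
  obtain ⟨v, hv⟩ := NCAb.mk_surjective (ρ a)
  ext
  rw [hΛ.topModule_smul ρ (v := c • v) (by rw [map_smul, map_smul, hv])]
  change _ = c • ((a • m : ncFiltration Λ (d + 1)) : Λ)
  rw [hΛ.topModule_smul ρ hv.symm, smul_mul_assoc]

end IsNCNilpotent

/-- The difference of two homomorphisms that agree modulo the last term of the NC-filtration is a
derivation, which vanishes on `F¹`. -/
theorem IsNCNilpotent.eq_on_ncFiltration_one {E : Type u} [Ring E] [Algebra ℂ E] {d : ℕ}
    (hΛ : IsNCNilpotent (d + 1) Λ) (f g : E →ₐ[ℂ] Λ)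
    (h : ∀ e, g e - f e ∈ ncFiltration Λ (d + 1)) {e : E} (he : e ∈ ncFiltration E 1) :
    g e = f e := by
  let D : E →ₗ[ℂ] Λ := g.toLinearMap - f.toLinearMap
  have hD : ∀ e, D e = g e - f e := fun e => rfl
  have hmul : ∀ a b, D (a * b) = f a * D b + D a * f b := fun a b => by
    have h0 := hΛ.mul_eq_zero_of_mem_of_mem (h a) (h b)
    rw [hD, hD, hD, map_mul, map_mul, ← sub_eq_zero, ← h0]
    noncomm_ring
  have hc := fun e => hΛ.mul_comm_of_mem (h e)
  have key := ncFiltration_le_of_filtration (d := 1)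
    (fun i => if i = 1 then ncFiltrationSubmodule E 1 ⊓ LinearMap.ker D else ⊤) rfl ?_ ?_ he
  · exact sub_eq_zero.1 key.2
  · intro i j x hx y hy
    by_cases hij : i + j = 1
    · rw [if_pos hij]
      rcases (by omega : i = 0 ∧ j = 1 ∨ i = 1 ∧ j = 0) with ⟨rfl, rfl⟩ | ⟨rfl, rfl⟩
      · refine ⟨Ideal.mul_mem_left (ncFiltration E 1) x hy.1, LinearMap.mem_ker.2 ?_⟩
        have h1 := hΛ.mul_eq_zero_of_mem (map_mem_ncFiltration f hy.1) (h x)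
        rw [hmul, show D y = 0 from hy.2, mul_zero, zero_add, hD, ← hc, h1]
      · refine ⟨Ideal.mul_mem_right y (ncFiltration E 1) hx.1, LinearMap.mem_ker.2 ?_⟩
        have h1 := hΛ.mul_eq_zero_of_mem (map_mem_ncFiltration f hx.1) (h y)
        rw [hmul, show D x = 0 from hx.2, zero_mul, add_zero, hD, h1]
    · rw [if_neg hij]
      trivial
  · intro i x y _
    by_cases hi : i + 1 = 1
    · rw [if_pos hi]
      refine ⟨commutator_mem_ncFiltration_one E x y, LinearMap.mem_ker.2 ?_⟩
      rw [map_sub, hmul, hmul, hD, hD, hc, hc]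
      abel
    · rw [if_neg hi]
      trivial

end TopPiece

section Smoothness

variable {R : Type u} [Ring R] [Algebra ℂ R]
variable {E : Type u} [Ring E] [Algebra ℂ E] {X : CentralExtension R (HochschildH2 R) E}

set_option maxHeartbeats 400000 in
theorem CentralExtension.IsUniversal.isFormallyNCSmooth {d : ℕ} (hR : IsDSmooth d R)
    (hX : X.IsUniversal) : IsFormallyNCSmooth (d + 1) E := by
  intro Λ' Λ _ _ _ _ hΛ' hΛ p hp hk f
  have hd : 1 ≤ d + 1 := Nat.le_add_left 1 d
  let q' := Ideal.Quotient.mkₐ ℂ (ncFiltration Λ' (d + 1))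
  let q := Ideal.Quotient.mkₐ ℂ (ncFiltration Λ (d + 1))
  have hq' : Function.Surjective q' := Ideal.Quotient.mkₐ_surjective _ _
  have hq0 : ∀ {x}, q x = 0 ↔ x ∈ ncFiltration Λ (d + 1) := Ideal.Quotient.eq_zero_iff_mem
  have hq0' : ∀ {x}, q' x = 0 ↔ x ∈ ncFiltration Λ' (d + 1) := Ideal.Quotient.eq_zero_iff_mem
  let pb : Λ' ⧸ ncFiltration Λ' (d + 1) →ₐ[ℂ] Λ ⧸ ncFiltration Λ (d + 1) :=
    Ideal.Quotient.liftₐ _ (q.comp p) fun x hx => hq0.2 (map_mem_ncFiltration p hx)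
  have hpb : ∀ x, pb (q' x) = q (p x) := fun x => rfl
  have hpb' : Function.Surjective pb := fun y => by
    obtain ⟨y, rfl⟩ := Ideal.Quotient.mkₐ_surjective ℂ _ y
    obtain ⟨x, rfl⟩ := hp y
    exact ⟨q' x, rfl⟩
  have hkb : IsNilpotent (RingHom.ker pb) :=
    Ideal.isNilpotent_of_forall_exists q'.toRingHom hq' (I := RingHom.ker p) (fun y hy => by
      obtain ⟨x, rfl⟩ := hq' y
      obtain ⟨z, hz, hzx⟩ := exists_mem_ncFiltration_of_surjective p hp 
        (show p x ∈ _ from hq0.1 hy)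
      refine ⟨x - z, by rw [RingHom.mem_ker, map_sub, hzx, sub_self], ?_⟩
      change q' (x - z) = q' x
      rw [map_sub, hq0'.2 hz, sub_zero]) hk
  obtain ⟨fb, hfb⟩ := AlgHom.exists_comp_eq_of_surjective X.proj X.proj_surjective (q.comp f)
    fun e he => by
      obtain ⟨m, rfl⟩ := (X.exact e).1 he
      exact hq0.2 (map_mem_ncFiltration f (hX.incl_mem hR m))
  obtain ⟨g, hg⟩ := hR.formallySmooth _ _ (isNCNilpotent_quotient d) (isNCNilpotent_quotient d)
    pb hpb' hkb fb
  have hg' : ∀ x, pb (g x) = fb x := fun x => DFunLike.congr_fun hg x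
  obtain ⟨l, hl⟩ := q'.toLinearMap.exists_rightInverse_of_surjective (LinearMap.range_eq_top.2 hq')
  let t : R →ₗ[ℂ] Λ' := l ∘ₗ g.toLinearMap
  have ht : ∀ x, q' (t x) = g x := fun x => LinearMap.congr_fun hl (g x)
  let r' : Λ' ⧸ ncFiltration Λ' (d + 1) →ₐ[ℂ] NCAb Λ' :=
    Ideal.Quotient.factorₐ ℂ (ncFiltration_antitone hd)
  let r : Λ ⧸ ncFiltration Λ (d + 1) →ₐ[ℂ] NCAb Λ :=
    Ideal.Quotient.factorₐ ℂ (ncFiltration_antitone hd)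
  let ρ' : NCAb R →ₐ[ℂ] NCAb Λ' := NCAb.lift (isNCNilpotent_ncAb 0) (r'.comp g)
  let ρ : NCAb R →ₐ[ℂ] NCAb Λ := NCAb.lift (isNCNilpotent_ncAb 0) (r.comp fb)
  have hρ' : ∀ {x v}, q' v = g x → ρ' (NCAb.mk R x) = NCAb.mk Λ' v := fun {x v} h => by
    change r' (g x) = _
    rw [← h]
    rfl
  have hρ : ∀ {x v}, q v = fb x → ρ (NCAb.mk R x) = NCAb.mk Λ v := fun {x v} h => by
    change r (fb x) = _
    rw [← h]
    rfl
  let _ := hΛ'.topModule ρ'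
  let _ := hΛ.topModule ρ
  have _ := hΛ'.topModule_isScalarTower ρ'
  have _ := hΛ.topModule_isScalarTower ρ
  let ι' : ncFiltration Λ' (d + 1) →ₗ[ℂ] Λ' := (ncFiltration Λ' (d + 1)).subtype.restrictScalars ℂ
  have hsmul' : ∀ {x v}, q' v = g x → ∀ m, v * ι' m = ι' (NCAb.mk R x • m) := fun h m =>
    (hΛ'.topModule_smul ρ' (hρ' h) m).symm
  have hsmul : ∀ {x v}, q v = fb x → ∀ m : ncFiltration Λ (d + 1),
      ((NCAb.mk R x • m : ncFiltration Λ (d + 1)) : Λ) = v * m := fun h m =>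
    hΛ.topModule_smul ρ (hρ h) m
  have hι' : ∀ m, ι' m ∈ ncFiltration Λ' (d + 1) := fun m => m.2
  have hmem : ∀ {x}, q' x = 0 → ∃ m, x = ι' m := fun {x} h => ⟨⟨x, hq0'.1 h⟩, rfl⟩
  have hcomm' : ∀ x m, ι' m * x = x * ι' m := fun x m => (hΛ'.mul_comm_of_mem (hι' m) x).symm
  obtain ⟨G, hG⟩ := hX.exists_algHom hR ι' Subtype.val_injective t
    (fun x m => hsmul' (ht x) m) (fun x m => by rw [hcomm', hsmul' (ht x) m])
    (fun m n => hΛ'.mul_eq_zero_of_mem_of_mem (hι' m) (hι' n))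
    (fun x y => hmem (by rw [map_sub, map_mul, ht, ht, ht, map_mul, sub_self]))
    (hmem (by rw [map_sub, ht, map_one, map_one, sub_self]))
  have hqG : ∀ e, q' (G e) = g (X.proj e) := fun e => by
    obtain ⟨m, hm⟩ := hG e
    rw [← sub_add_cancel (G e) (t (X.proj e)), hm, map_add, hq0'.2 (hι' m), zero_add, ht]
  have hqpG : ∀ e, q (p (G e)) = fb (X.proj e) := fun e => by rw [← hpb, hqG, hg']
  have hD : ∀ e, (p.comp G) e - f e ∈ ncFiltration Λ (d + 1) := fun e => by
    refine hq0.1 ?_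
    rw [map_sub, AlgHom.comp_apply, hqpG, hfb, AlgHom.comp_apply, sub_self]
  have hD1 : ∀ m, p (G (X.incl m)) = f (X.incl m) := fun m =>
    hΛ.eq_on_ncFiltration_one f (p.comp G) hD (ncFiltration_antitone hd (hX.incl_mem hR m))
  obtain ⟨s, c, hs, hsc, -⟩ := id hX
  let δ : R →ₗ[ℂ] ncFiltration Λ (d + 1) :=
    { toFun := fun x => ⟨p (G (s x)) - f (s x), hD (s x)⟩
      map_add' := fun x y => Subtype.ext (by
        change p (G (s (x + y))) - f (s (x + y)) = (p (G (s x)) - f (s x)) + (p (G (s y)) - f (s y))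
        simp only [map_add]
        abel)
      map_smul' := fun a x => Subtype.ext (by
        change p (G (s (a • x))) - f (s (a • x)) = a • (p (G (s x)) - f (s x))
        simp only [map_smul, smul_sub]) }
  have hδv : ∀ x, (δ x : Λ) = p (G (s x)) - f (s x) := fun x => rfl
  have hδ : ∀ x y, δ (x * y) = NCAb.mk R x • δ y + NCAb.mk R y • δ x := fun x y => by
    have h1 : s (x * y) = s x * s y - X.incl (c x y) := by rw [hsc, add_sub_cancel_right]
    have hx : q (p (G (s x))) = fb x := by rw [hqpG, hs]
    have hy : q (f (s y)) = fb y := by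
      have := hfb (s y)
      rw [hs] at this
      exact this.symm
    ext
    rw [Submodule.coe_add, hsmul hx, hsmul hy, hδv, h1, hΛ.mul_comm_of_mem (δ x).2, hδv, hδv]
    simp only [map_sub, map_mul, hD1]
    noncomm_ring
  let π : ncFiltration Λ' (d + 1) →ₗ[NCAb R] ncFiltration Λ (d + 1) :=
    { toFun := fun m => ⟨p m, map_mem_ncFiltration p m.2⟩
      map_add' := fun m n => Subtype.ext (map_add p _ _)
      map_smul' := fun a m => by
        obtain ⟨x, rfl⟩ := NCAb.mk_surjective a
        ext
        rw [RingHom.id_apply, hsmul (v := p (t x)) (by rw [← hpb, ht, hg'])]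
        change p (ι' (NCAb.mk R x • m)) = p (t x) * p m
        rw [← hsmul' (ht x), map_mul]
        rfl }
  have hπ : Function.Surjective π := fun y => by
    obtain ⟨x, hx, hxy⟩ := exists_mem_ncFiltration_of_surjective p hp y.2
    exact ⟨⟨x, hx⟩, Subtype.ext hxy⟩
  obtain ⟨δ', hδ', hπδ⟩ := hR.exists_derivation_lift π hπ δ hδ
  let G' : E →ₗ[ℂ] Λ' := G.toLinearMap - ι' ∘ₗ δ' ∘ₗ X.proj.toLinearMap
  have hG' : ∀ e, G' e = G e - ι' (δ' (X.proj e)) := fun e => rfl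
  have hδ1 : δ' 1 = 0 := by
    have := hδ' 1 1
    simpa using this
  refine ⟨AlgHom.ofLinearMap G' (by rw [hG', map_one, map_one, hδ1, map_zero, sub_zero])
    fun e e' => ?_, AlgHom.ext fun e => ?_⟩
  · have h0 : ι' (δ' (X.proj e)) * ι' (δ' (X.proj e')) = 0 :=
      hΛ'.mul_eq_zero_of_mem_of_mem (hι' _) (hι' _)
    rw [hG', hG', hG', map_mul, map_mul, hδ', map_add, ← hsmul' (hqG e), ← hsmul' (hqG e'),
      sub_mul, mul_sub, mul_sub, h0, hcomm' (G e')]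
    abel
  · have h1 : p (ι' (δ' (X.proj e))) = p (G (s (X.proj e))) - f (s (X.proj e)) :=
      congrArg Subtype.val (hπδ (X.proj e))
    obtain ⟨m, hm⟩ := (X.exact (e - s (X.proj e))).1 (by rw [map_sub, hs, sub_self])
    change p (G e - ι' (δ' (X.proj e))) = f e
    have h2 : s (X.proj e) = e - X.incl m := by rw [hm, sub_sub_cancel]
    rw [map_sub, h1, h2]
    simp only [map_sub, hD1]
    abel

theorem CentralExtension.IsUniversal.isDSmooth {d : ℕ} (hR : IsDSmooth d R)
    (hX : X.IsUniversal) : IsDSmooth (d + 1) E where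
  finiteType := by
    obtain ⟨ψ, -⟩ := hX.exists_ncAb_equiv hR
    have := hR.finiteType
    have : Algebra.FiniteType ℂ (NCAb R) :=
      Algebra.FiniteType.of_surjective (NCAb.mk R) NCAb.mk_surjective
    exact (X.isNCNilpotent hR.ncNilpotent).finiteType (this.equiv ψ.symm)
  ncNilpotent := X.isNCNilpotent hR.ncNilpotent
  formallySmooth := hX.isFormallyNCSmooth hR

theorem exists_dSmoothThickening (A : Type u) [CommRing A] [Algebra ℂ A] [Algebra.Smooth ℂ A]
    (d : ℕ) :
    ∃ (R : Type u) (_ : Ring R) (_ : Algebra ℂ R), Nonempty (DSmoothThickening d A R) := by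
  induction d with
  | zero =>
    refine ⟨A, inferInstance, inferInstance, ⟨IsDSmooth.of_smooth A, ?_⟩⟩
    refine (AlgEquiv.ofBijective (NCAb.mk A) ⟨(injective_iff_map_eq_zero _).2 fun x hx => ?_,
      NCAb.mk_surjective⟩).symm
    exact (isNCNilpotent_of_commRing A 0).eq_zero le_rfl (NCAb.mk_eq_zero.1 hx)
  | succ d ih =>
    obtain ⟨R, _, _, ⟨T⟩⟩ := ih
    obtain ⟨E, _, _, X, hX⟩ := T.dSmooth.exists_universal
    obtain ⟨ψ, -⟩ := hX.exists_ncAb_equiv T.dSmooth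
    exact ⟨E, inferInstance, inferInstance, ⟨hX.isDSmooth T.dSmooth, ψ.trans T.iso⟩⟩

end Smoothness

section Generators

variable {R : Type u} [Ring R] [Algebra ℂ R] {ι : Type*} {x : ι → R}

theorem commutator_mem_of_adjoin_eq_top (hx : Algebra.adjoin ℂ (Set.range x) = ⊤) {n : ℕ}
    {S : Submodule ℂ R} (h : ∀ i, ∀ u ∈ ncFiltration R n, x i * u - u * x i ∈ S) (r : R) :
    ∀ u ∈ ncFiltration R n, r * u - u * r ∈ S := by
  have hr : r ∈ Algebra.adjoin ℂ (Set.range x) := by rw [hx]; trivial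
  induction hr using Algebra.adjoin_induction with
  | mem r hr =>
    obtain ⟨i, rfl⟩ := hr
    exact h i
  | algebraMap c =>
    intro u _
    rw [Algebra.commutes, sub_self]
    exact zero_mem _
  | add a b _ _ ha hb =>
    intro u hu
    convert add_mem (ha u hu) (hb u hu) using 1
    noncomm_ring
  | mul a b _ _ ha hb =>
    intro u hu
    convert add_mem (ha (b * u) (Ideal.mul_mem_left _ b hu))
      (hb (u * a) (Ideal.mul_mem_right a _ hu)) using 1
    noncomm_ring

/-- Modulo `F^{n+2}`, the space `F^{n+1}` is the sum of all `[xᵢ, F^n]` and `[xᵢ, xⱼ] F^n`, where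
`xᵢ` are generators of the algebra. -/
theorem ncFiltration_succ_induction_generators (hx : Algebra.adjoin ℂ (Set.range x) = ⊤) {n : ℕ}
    {S : Submodule ℂ R} (h1 : ∀ i, ∀ u ∈ ncFiltration R n, x i * u - u * x i ∈ S)
    (h2 : ∀ i j, ∀ u ∈ ncFiltration R n, (x i * x j - x j * x i) * u ∈ S)
    (h3 : ∀ u ∈ ncFiltration R (n + 2), u ∈ S) {y : R} (hy : y ∈ ncFiltration R (n + 1)) :
    y ∈ S := by
  refine ncFiltration_succ_induction (commutator_mem_of_adjoin_eq_top hx h1) ?_ hy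
  intro v hv
  let T : Submodule ℂ R :=
    { carrier := {v | v ∈ ncFiltration R 1 ∧ ∀ u ∈ ncFiltration R n, v * u ∈ S}
      add_mem' := fun {a b} ha hb => ⟨add_mem ha.1 hb.1, fun u hu => by
        rw [add_mul]
        exact add_mem (ha.2 u hu) (hb.2 u hu)⟩
      zero_mem' := ⟨zero_mem _, fun u _ => by simp⟩
      smul_mem' := fun c a ha => ⟨smul_mem_ncFiltration c ha.1, fun u hu => by
        rw [smul_mul_assoc]
        exact S.smul_mem c (ha.2 u hu)⟩ }
  have hTr : ∀ v ∈ T, ∀ r, v * r ∈ T := fun v hv r => ⟨Ideal.mul_mem_right r _ hv.1, fun u hu => by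
    rw [mul_assoc]
    exact hv.2 _ (Ideal.mul_mem_left _ r hu)⟩
  have hTl : ∀ r, ∀ v ∈ T, r * v ∈ T := fun r v hv => ⟨Ideal.mul_mem_left _ r hv.1, fun u hu => by
    have e : r * v * u = (r * v - v * r) * u + v * (r * u) := by noncomm_ring
    rw [e]
    refine add_mem (h3 _ ?_) (hv.2 _ (Ideal.mul_mem_left _ r hu))
    rw [add_comm n]
    exact mul_mem_ncFiltration (commutator_mem_ncFiltration_succ r hv.1) hu⟩
  have hgen : ∀ b : R, (∀ i, x i * b - b * x i ∈ T) → ∀ r, r * b - b * r ∈ T := by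
    intro b hb r
    have hr : r ∈ Algebra.adjoin ℂ (Set.range x) := by rw [hx]; trivial
    induction hr using Algebra.adjoin_induction with
    | mem r hr =>
      obtain ⟨i, rfl⟩ := hr
      exact hb i
    | algebraMap c =>
      rw [Algebra.commutes, sub_self]
      exact zero_mem _
    | add a b _ _ ha hb =>
      convert add_mem ha hb using 1
      noncomm_ring
    | mul a c _ _ ha hc =>
      convert add_mem (hTl a _ hc) (hTr _ ha c) using 1
      noncomm_ring
  have hcomm : ∀ a b : R, a * b - b * a ∈ T := fun a b => by
    refine hgen b (fun i => ?_) a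
    rw [← neg_sub, neg_mem_iff]
    refine hgen (x i) (fun j => ?_) b
    exact ⟨commutator_mem_ncFiltration_one R _ _, h2 j i⟩
  have key := ncFiltration_le_of_filtration (d := 1) (fun i => if i = 1 then T else ⊤) rfl ?_ ?_ hv
  · exact key.2
  · intro i j a ha b hb
    by_cases hij : i + j = 1
    · rw [if_pos hij]
      rcases (by omega : i = 0 ∧ j = 1 ∨ i = 1 ∧ j = 0) with ⟨rfl, rfl⟩ | ⟨rfl, rfl⟩
      · exact hTl a b hb
      · exact hTr a ha b
    · rw [if_neg hij]
      trivial
  · intro i a b _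
    by_cases hi : i + 1 = 1
    · rw [if_pos hi]
      exact hcomm a b
    · rw [if_neg hi]
      trivial

end Generators

section InverseLimit

theorem exists_compatible_extension (d : ℕ) : ∀ {V : ℕ → Type u} (π : ∀ n, V (n + 1) → V n),
    (∀ n, Function.Surjective (π n)) → ∀ y : V d,
      ∃ x : ∀ n, V n, (∀ n, π n (x (n + 1)) = x n) ∧ x d = y := by
  induction d with
  | zero =>
    intro V π hπ y
    choose s hs using hπ
    exact ⟨fun n => Nat.rec y (fun n v => s n v) n, fun n => hs n _, rfl⟩
  | succ d ih =>
    intro V π hπ y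
    obtain ⟨x, hx, hxd⟩ := ih (V := fun n => V (n + 1)) (fun n => π (n + 1)) (fun n => hπ (n + 1)) y
    refine ⟨fun n => Nat.casesOn n (π 0 (x 0)) x, fun n => ?_, hxd⟩
    cases n with
    | zero => rfl
    | succ n => exact hx n

variable {V : ℕ → Type u} [∀ n, Ring (V n)] [∀ n, Algebra ℂ (V n)]

/-- The inverse limit of a tower of algebras. -/
def towerLimit (π : ∀ n, V (n + 1) →ₐ[ℂ] V n) : Subalgebra ℂ (∀ n, V n) where
  carrier := {x | ∀ n, π n (x (n + 1)) = x n}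
  mul_mem' := fun hx hy n => by rw [Pi.mul_apply, map_mul, hx n, hy n, Pi.mul_apply]
  add_mem' := fun hx hy n => by rw [Pi.add_apply, map_add, hx n, hy n, Pi.add_apply]
  algebraMap_mem' := fun c n => by
    rw [Pi.algebraMap_apply, AlgHom.commutes, Pi.algebraMap_apply]

/-- A tower of surjections of NC-nilpotent algebras, each of which is the largest quotient of the
next one that is NC-nilpotent of the given degree. -/
structure IsNCTower (π : ∀ n, V (n + 1) →ₐ[ℂ] V n) : Prop where
  surjective : ∀ n, Function.Surjective (π n)
  nilpotent : ∀ n, IsNCNilpotent n (V n)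
  ker : ∀ n x, π n x = 0 → x ∈ ncFiltration (V (n + 1)) (n + 1)
  finiteType : Algebra.FiniteType ℂ (V 0)

namespace towerLimit

variable {π : ∀ n, V (n + 1) →ₐ[ℂ] V n}

variable (π) in
/-- The projection from the inverse limit of a tower. -/
def proj (n : ℕ) : towerLimit π →ₐ[ℂ] V n := (Pi.evalAlgHom ℂ V n).comp (towerLimit π).val

theorem map_proj (x : towerLimit π) (n : ℕ) : π n (proj π (n + 1) x) = proj π n x := x.2 n

theorem ext_proj {x y : towerLimit π} (h : ∀ n, proj π n x = proj π n y) : x = y :=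
  Subtype.ext (funext h)

variable (π) in
/-- The filtration of the inverse limit of a tower by the elements all of whose components lie in
the given term of the NC-filtration. -/
def closedFiltration (n : ℕ) : Submodule ℂ (towerLimit π) :=
  ⨅ m, (ncFiltrationSubmodule (V m) n).comap (proj π m).toLinearMap

theorem mem_closedFiltration {n : ℕ} {x : towerLimit π} :
    x ∈ closedFiltration π n ↔ ∀ m, proj π m x ∈ ncFiltration (V m) n := by
  simp only [closedFiltration, Submodule.mem_iInf, Submodule.mem_comap]
  rfl

theorem closedFiltration_antitone : Antitone (closedFiltration π) := fun _ _ h _ hx =>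
  mem_closedFiltration.2 fun m => ncFiltration_antitone h (mem_closedFiltration.1 hx m)

theorem commutator_mem_closedFiltration {n : ℕ} (a : towerLimit π) {x : towerLimit π}
    (hx : x ∈ closedFiltration π n) : a * x - x * a ∈ closedFiltration π (n + 1) :=
  mem_closedFiltration.2 fun m => by
    rw [map_sub, map_mul, map_mul]
    exact commutator_mem_ncFiltration_succ _ (mem_closedFiltration.1 hx m)

theorem commutator_mul_mem_closedFiltration {n : ℕ} (a b : towerLimit π) {x : towerLimit π}
    (hx : x ∈ closedFiltration π n) : (a * b - b * a) * x ∈ closedFiltration π (n + 1) :=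
  mem_closedFiltration.2 fun m => by
    rw [map_mul, add_comm n]
    exact mul_mem_ncFiltration
      (map_mem_ncFiltration (proj π m) (commutator_mem_ncFiltration_one _ a b))
      (mem_closedFiltration.1 hx m)

theorem proj_surjective (h : IsNCTower π) (n : ℕ) : Function.Surjective (proj π n) := fun y => by
  obtain ⟨x, hx, hxy⟩ := exists_compatible_extension n (fun n => π n) h.surjective y
  exact ⟨⟨x, hx⟩, hxy⟩

theorem mem_closedFiltration_of_proj (h : IsNCTower π) {m n : ℕ} (hn : n ≤ m + 1) {x : towerLimit π}
    (hx : proj π m x ∈ ncFiltration (V m) n) : x ∈ closedFiltration π n := by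
  refine mem_closedFiltration.2 fun k => ?_
  rcases le_total k m with hk | hk
  · refine Nat.decreasingInduction' (fun j _ _ hj => ?_) hk hx
    rw [← map_proj]
    exact map_mem_ncFiltration (π j) hj
  · induction k, hk using Nat.le_induction with
    | base => exact hx
    | succ k hk ih =>
      rw [← map_proj] at ih
      obtain ⟨y, hy, hyx⟩ := exists_mem_ncFiltration_of_surjective (π k) (h.surjective k) ih
      have h1 := h.ker k (proj π (k + 1) x - y) (by rw [map_sub, hyx, sub_self])
      have := add_mem (ncFiltration_antitone (show n ≤ k + 1 by omega) h1) hy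
      rwa [sub_add_cancel] at this

theorem mem_closedFiltration_of_proj_eq_zero (h : IsNCTower π) {m : ℕ} {x : towerLimit π}
    (hx : proj π m x = 0) :
    x ∈ closedFiltration π (m + 1) :=
  mem_closedFiltration_of_proj h le_rfl (by rw [hx]; exact zero_mem _)

theorem proj_eq_zero (h : IsNCTower π) {m n : ℕ} (hn : m + 1 ≤ n) {x : towerLimit π}
    (hx : x ∈ closedFiltration π n) : proj π m x = 0 :=
  (h.nilpotent m).eq_zero hn (mem_closedFiltration.1 hx m)

theorem eq_zero_of_forall_mem (h : IsNCTower π) {x : towerLimit π}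
    (hx : ∀ n, x ∈ closedFiltration π n) : x = 0 :=
  ext_proj fun m => by rw [proj_eq_zero h le_rfl (hx (m + 1)), map_zero]

theorem exists_sum (h : IsNCTower π) {n : ℕ} (w : ℕ → towerLimit π)
    (hw : ∀ j, w j ∈ closedFiltration π (n + j)) :
    ∃ x, ∀ N, x - ∑ j ∈ Finset.range N, w j ∈ closedFiltration π (n + N) := by
  have h0 : ∀ m j, m + 1 ≤ j → proj π m (w j) = 0 := fun m j hj =>
    proj_eq_zero h (show m + 1 ≤ n + j by omega) (hw j)
  refine ⟨⟨fun m => ∑ j ∈ Finset.range (m + 1), proj π m (w j), fun m => ?_⟩, fun N => ?_⟩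
  · simp only [map_sum, map_proj]
    rw [Finset.sum_range_succ, h0 m (m + 1) le_rfl, add_zero]
  · refine mem_closedFiltration.2 fun m => ?_
    rw [map_sub, map_sum]
    change ∑ j ∈ Finset.range (m + 1), proj π m (w j) - _ ∈ _
    rcases le_total N (m + 1) with hN | hN
    · rw [← Finset.sum_Ico_eq_sub _ hN]
      refine sum_mem fun j hj => mem_closedFiltration.1 (closedFiltration_antitone ?_ (hw j)) m
      have := (Finset.mem_Ico.1 hj).1
      omega
    · rw [← neg_sub, neg_mem_iff, ← Finset.sum_Ico_eq_sub _ hN]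
      refine sum_mem fun j hj => ?_
      rw [h0 m j (Finset.mem_Ico.1 hj).1]
      exact zero_mem _

theorem exists_generators (h : IsNCTower π) : ∃ (ι : Type u) (_ : Fintype ι) (x : ι → towerLimit π),
    ∀ m, Algebra.adjoin ℂ (Set.range fun i => proj π m (x i)) = ⊤ := by
  obtain ⟨s, hs⟩ := h.finiteType.out
  choose l hl using proj_surjective h 0
  refine ⟨s, inferInstance, fun i => l i, fun m => (h.nilpotent m).eq_top_of_forall _ fun v => ?_⟩
  obtain ⟨y, rfl⟩ := proj_surjective h m v
  have hy : proj π 0 y ∈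
      (Algebra.adjoin ℂ (Set.range fun i : s => l i)).map (proj π 0) := by
    rw [AlgHom.map_adjoin, ← Set.range_comp]
    have : (proj π 0 ∘ fun i : s => l i) = Subtype.val := funext fun i => hl i
    rw [this, Subtype.range_coe_subtype]
    change _ ∈ Algebra.adjoin ℂ (s : Set (V 0))
    rw [hs]
    trivial
  obtain ⟨b, hb, hby⟩ := hy
  refine ⟨proj π m b, ?_, ?_⟩
  · have : proj π m b ∈ (Algebra.adjoin ℂ (Set.range fun i : s => l i)).map (proj π m) :=
      ⟨b, hb, rfl⟩
    rwa [AlgHom.map_adjoin, ← Set.range_comp] at this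
  · rw [← map_sub]
    refine mem_closedFiltration.1 (mem_closedFiltration_of_proj_eq_zero (m := 0) h ?_) m
    rw [map_sub, sub_eq_zero]
    exact hby.symm

/-- The operators `[xᵢ, -]` and `[xᵢ, xⱼ] -` attached to a family of elements. -/
def commutatorOperator {R : Type*} [Ring R] [Algebra ℂ R] {ι : Type*} (x : ι → R) :
    ι ⊕ ι × ι → R →ₗ[ℂ] R
  | .inl i => LinearMap.mulLeft ℂ (x i) - LinearMap.mulRight ℂ (x i)
  | .inr (i, j) => LinearMap.mulLeft ℂ (x i * x j - x j * x i)

theorem commutatorOperator_mem_closedFiltration {ι : Type*} (x : ι → towerLimit π) {n : ℕ}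
    {z : towerLimit π} (hz : z ∈ closedFiltration π n) (k : ι ⊕ ι × ι) :
    commutatorOperator x k z ∈ closedFiltration π (n + 1) :=
  match k with
  | .inl i => commutator_mem_closedFiltration (x i) hz
  | .inr (i, j) => commutator_mul_mem_closedFiltration (x i) (x j) hz

theorem commutatorOperator_mem_ncFiltration {R : Type u} [Ring R] [Algebra ℂ R] {ι : Type*}
    (x : ι → R) {n : ℕ} {z : R} (hz : z ∈ ncFiltration R n) (k : ι ⊕ ι × ι) :
    commutatorOperator x k z ∈ ncFiltration R (n + 1) :=
  match k with
  | .inl i => commutator_mem_ncFiltration_succ (x i) hz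
  | .inr (i, j) => by
    rw [add_comm n]
    exact mul_mem_ncFiltration (commutator_mem_ncFiltration_one R (x i) (x j)) hz

theorem exists_sub_sum_mem (h : IsNCTower π) {ι : Type u} [Fintype ι] {x : ι → towerLimit π}
    (hx : ∀ m, Algebra.adjoin ℂ (Set.range fun i => proj π m (x i)) = ⊤) {m : ℕ}
    {y : towerLimit π} (hy : y ∈ closedFiltration π (m + 1)) :
    ∃ z : ι ⊕ ι × ι → towerLimit π, (∀ k, z k ∈ closedFiltration π m) ∧
      y - ∑ k, commutatorOperator x k (z k) ∈ closedFiltration π (m + 2) := by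
  classical
  let S : Submodule ℂ (V (m + 1)) :=
    (⨆ k, (closedFiltration π m).map (commutatorOperator x k)).map (proj π (m + 1)).toLinearMap
  have hop : ∀ k, ∀ u ∈ closedFiltration π m, proj π (m + 1) (commutatorOperator x k u) ∈ S :=
    fun k u hu => Submodule.mem_map_of_mem
      (Submodule.mem_iSup_of_mem k (Submodule.mem_map_of_mem hu))
  have hlift : ∀ u ∈ ncFiltration (V (m + 1)) m, ∃ v ∈ closedFiltration π m,
      proj π (m + 1) v = u := fun u hu => by
    obtain ⟨v, rfl⟩ := proj_surjective h (m + 1) u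
    exact ⟨v, mem_closedFiltration_of_proj h (by omega) hu, rfl⟩
  have hyS : proj π (m + 1) y ∈ S := by
    refine ncFiltration_succ_induction_generators (hx (m + 1)) ?_ ?_ ?_
      (mem_closedFiltration.1 hy (m + 1))
    · intro i u hu
      obtain ⟨v, hv, rfl⟩ := hlift u hu
      have := hop (.inl i) v hv
      simpa [commutatorOperator] using this
    · intro i j u hu
      obtain ⟨v, hv, rfl⟩ := hlift u hu
      have := hop (.inr (i, j)) v hv
      simpa [commutatorOperator] using this
    · intro u hu
      rw [(h.nilpotent (m + 1)).eq_zero le_rfl hu]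
      exact zero_mem _
  obtain ⟨v, hv, hvy⟩ := hyS
  obtain ⟨f, hf, rfl⟩ := (Submodule.mem_iSup_iff_exists_finsupp _ _).1 hv
  choose z hz hzf using hf
  refine ⟨z, hz, mem_closedFiltration_of_proj_eq_zero h ?_⟩
  rw [map_sub, sub_eq_zero, ← hvy]
  simp only [hzf]
  rw [Finsupp.sum_fintype _ _ fun _ => rfl]
  rfl

/-- The closed filtration of the inverse limit is its NC-filtration. -/
theorem mem_ncFiltration_of_mem_closedFiltration (h : IsNCTower π) {n : ℕ} :
    ∀ {y : towerLimit π}, y ∈ closedFiltration π n → y ∈ ncFiltration (towerLimit π) n := by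
  obtain ⟨ι, _, x, hx⟩ := exists_generators h
  induction n with
  | zero => exact fun _ => mem_ncFiltration_zero _
  | succ n ih =>
    intro y hy
    let D : (ι ⊕ ι × ι → towerLimit π) → towerLimit π := fun z => ∑ k, commutatorOperator x k (z k)
    have hDsub : ∀ z z', D (z - z') = D z - D z' := fun z z' => by
      simp only [D, Pi.sub_apply, map_sub, Finset.sum_sub_distrib]
    have hDmem : ∀ {m z}, (∀ k, z k ∈ closedFiltration π m) → D z ∈ closedFiltration π (m + 1) :=
      fun hz => sum_mem fun k _ => commutatorOperator_mem_closedFiltration x (hz k) k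
    have step : ∀ m (y : closedFiltration π (m + 1)), ∃ z : ι ⊕ ι × ι → towerLimit π,
        (∀ k, z k ∈ closedFiltration π m) ∧ (y : towerLimit π) - D z ∈ closedFiltration π (m + 2) :=
      fun m y => exists_sub_sum_mem h hx y.2
    choose z hz hyz using step
    let Y : ∀ j, closedFiltration π (n + j + 1) := fun j =>
      Nat.rec ⟨y, hy⟩ (fun j v => ⟨v - D (z (n + j) v), hyz (n + j) v⟩) j
    have hY : ∀ j, (Y (j + 1)).1 = (Y j).1 - D (z (n + j) (Y j)) := fun j => rfl
    have hsum := fun k => exists_sum h (n := n) (fun j => z (n + j) (Y j) k) fun j => hz _ _ k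
    choose Z hZ using hsum
    have hYN : ∀ N, (Y N).1 =
        y - D (fun k => ∑ j ∈ Finset.range N, z (n + j) (Y j) k) := by
      intro N
      induction N with
      | zero => simp [D, Y]
      | succ N ihN =>
        rw [hY, ihN, sub_sub]
        congr 1
        simp only [D, Finset.sum_range_succ, map_add, Finset.sum_add_distrib]
    have hyD : y = D Z := by
      rw [← sub_eq_zero]
      refine eq_zero_of_forall_mem h fun N => ?_
      have e : y - D Z = (Y N).1 - D (Z - fun k => ∑ j ∈ Finset.range N, z (n + j) (Y j) k) := by
        rw [hDsub, hYN]
        abel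
      rw [e]
      exact sub_mem (closedFiltration_antitone (by omega) (Y N).2)
        (closedFiltration_antitone (show N ≤ n + N + 1 by omega) (hDmem fun k => hZ k N))
    rw [hyD]
    refine sum_mem fun k _ => commutatorOperator_mem_ncFiltration x (ih ?_) k
    have := hZ k 0
    simpa using this

theorem mem_ncFiltration_iff (h : IsNCTower π) {n : ℕ} {y : towerLimit π} :
    y ∈ ncFiltration (towerLimit π) n ↔ y ∈ closedFiltration π n :=
  ⟨fun hy => mem_closedFiltration.2 fun m => map_mem_ncFiltration (proj π m) hy,
    mem_ncFiltration_of_mem_closedFiltration h⟩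

theorem proj_eq_zero_iff (h : IsNCTower π) {n : ℕ} {y : towerLimit π} :
    proj π n y = 0 ↔ y ∈ ncFiltration (towerLimit π) (n + 1) :=
  ⟨fun hy => (mem_ncFiltration_iff h).2 (mem_closedFiltration_of_proj_eq_zero h hy),
    fun hy => proj_eq_zero h le_rfl ((mem_ncFiltration_iff h).1 hy)⟩

theorem exists_quotient_equiv (h : IsNCTower π) (n : ℕ) :
    Nonempty ((towerLimit π ⧸ ncFiltration (towerLimit π) (n + 1)) ≃ₐ[ℂ] V n) := by
  refine ⟨AlgEquiv.ofBijective
    (Ideal.Quotient.liftₐ _ (proj π n) fun y hy => (proj_eq_zero_iff h).2 hy)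
    ⟨(injective_iff_map_eq_zero _).2 fun y hy => ?_, fun v => ?_⟩⟩
  · obtain ⟨y, rfl⟩ := Ideal.Quotient.mk_surjective y
    exact Ideal.Quotient.eq_zero_iff_mem.2 ((proj_eq_zero_iff h).1 hy)
  · obtain ⟨y, rfl⟩ := proj_surjective h n v
    exact ⟨Ideal.Quotient.mk _ y, rfl⟩

theorem isNCComplete (h : IsNCTower π) : IsNCComplete (towerLimit π) := by
  refine ⟨(injective_iff_map_eq_zero _).2 fun x hx => ?_, fun y => ?_⟩
  · refine eq_zero_of_forall_mem h fun n => (mem_ncFiltration_iff h).1 ?_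
    exact Ideal.Quotient.eq_zero_iff_mem.1 (congrFun (congrArg Subtype.val hx) n)
  · choose l hl using fun n => Ideal.Quotient.mk_surjective (y.1 n)
    have hl1 : ∀ n, l (n + 1) - l n ∈ ncFiltration (towerLimit π) n := fun n => by
      refine Ideal.Quotient.eq.1 ?_
      rw [hl n, ← y.2 n, ← hl (n + 1)]
      rfl
    have hl2 : ∀ m n, m ≤ n → l n - l m ∈ ncFiltration (towerLimit π) m := fun m n hmn => by
      induction n, hmn using Nat.le_induction with
      | base => rw [sub_self]; exact zero_mem _
      | succ n hmn ih =>
        rw [← sub_add_sub_cancel _ (l n)]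
        exact add_mem (ncFiltration_antitone hmn (hl1 n)) ih
    have hpl : ∀ m n, m + 1 ≤ n → proj π m (l n) = proj π m (l (m + 1)) := fun m n hmn => by
      rw [← sub_eq_zero, ← map_sub]
      exact (proj_eq_zero_iff h).2 (hl2 _ _ hmn)
    let x : towerLimit π := ⟨fun m => proj π m (l (m + 1)), fun m => by
      rw [map_proj, hpl m (m + 1 + 1) (by omega)]⟩
    have hx : ∀ m, proj π m x = proj π m (l (m + 1)) := fun m => rfl
    refine ⟨x, Subtype.ext (funext fun n => ?_)⟩
    rw [← hl n]
    refine Ideal.Quotient.eq.2 ((mem_ncFiltration_iff h).2 (mem_closedFiltration.2 fun m => ?_))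
    rw [map_sub, hx]
    rcases le_total n (m + 1) with hn | hn
    · rw [← map_sub]
      exact map_mem_ncFiltration _ (hl2 _ _ hn)
    · rw [hpl m n hn, sub_self]
      exact zero_mem _

end towerLimit

end InverseLimit

section Existence

theorem DSmoothThickening.exists_quotientMap {A : Type u} [CommRing A] [Algebra ℂ A]
    {R R' : Type u} [Ring R] [Algebra ℂ R] [Ring R'] [Algebra ℂ R'] {d : ℕ}
    (T : DSmoothThickening (d + 1) A R) (T' : DSmoothThickening d A R') :
    ∃ f : R →ₐ[ℂ] R', Function.Surjective f ∧ ∀ x, f x = 0 → x ∈ ncFiltration R (d + 1) := by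
  let q := Ideal.Quotient.mkₐ ℂ (ncFiltration R (d + 1))
  have hq : Function.Surjective q := Ideal.Quotient.mkₐ_surjective _ _
  have hq0 : ∀ x, q x = 0 → x ∈ ncFiltration R (d + 1) := fun x => Ideal.Quotient.eq_zero_iff_mem.1
  obtain ⟨ψ, -⟩ := exists_ncAb_equiv_of_surjective q hq fun x hx =>
    ncFiltration_antitone (Nat.le_add_left 1 d) (hq0 x hx)
  let T₁ : DSmoothThickening d A (R ⧸ ncFiltration R (d + 1)) :=
    ⟨T.dSmooth.quotient (Nat.le_succ d), ψ.symm.trans T.iso⟩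
  obtain ⟨e, -⟩ := T₁.exists_algEquiv T'
  refine ⟨e.toAlgHom.comp q, e.surjective.comp hq, fun x hx => hq0 x ?_⟩
  exact e.injective (hx.trans (map_zero e).symm)

theorem exists_ncSmoothThickening (A : Type u) [CommRing A] [Algebra ℂ A] [Algebra.Smooth ℂ A] :
    ∃ (R : Type u) (_ : Ring R) (_ : Algebra ℂ R), Nonempty (NCSmoothThickening A R) := by
  choose V _ _ hT using exists_dSmoothThickening A
  let T : ∀ d, DSmoothThickening d A (V d) := fun d => (hT d).some
  choose π hπ hπ' using fun d => (T (d + 1)).exists_quotientMap (T d)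
  have h : IsNCTower π := ⟨hπ, fun n => (T n).dSmooth.ncNilpotent, hπ', (T 0).dSmooth.finiteType⟩
  obtain ⟨ψ, -⟩ := exists_ncAb_equiv_of_surjective (towerLimit.proj π 0)
    (towerLimit.proj_surjective h 0) fun x hx => (towerLimit.proj_eq_zero_iff h).1 hx
  refine ⟨towerLimit π, inferInstance, inferInstance,
    ⟨⟨towerLimit.isNCComplete h, fun d => ?_⟩, ψ.trans (T 0).iso⟩⟩
  obtain ⟨e⟩ := towerLimit.exists_quotient_equiv h d
  exact (T d).dSmooth.of_equiv e.symm

end Existence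

theorem theorem1p6p1 :
    -- existence and uniqueness of thickenings of smooth commutative algebras
    (∀ (A : Type u) [CommRing A] [Algebra ℂ A] [Algebra.Smooth ℂ A],
      (∀ d : ℕ,
        (∃ (R : Type u) (_ : Ring R) (_ : Algebra ℂ R), Nonempty (DSmoothThickening d A R)) ∧
        ∀ (R R' : Type u) [Ring R] [Algebra ℂ R] [Ring R'] [Algebra ℂ R']
          (T : DSmoothThickening d A R) (T' : DSmoothThickening d A R'),
          ∃ φ : R ≃ₐ[ℂ] R', ∀ x : R, T'.iso (NCAb.mk R' (φ x)) = T.iso (NCAb.mk R x)) ∧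
      (∃ (R : Type u) (_ : Ring R) (_ : Algebra ℂ R), Nonempty (NCSmoothThickening A R)) ∧
      (∀ (R R' : Type u) [Ring R] [Algebra ℂ R] [Ring R'] [Algebra ℂ R']
        (T : NCSmoothThickening A R) (T' : NCSmoothThickening A R'),
        ∃ φ : R ≃ₐ[ℂ] R', ∀ x : R, T'.iso (NCAb.mk R' (φ x)) = T.iso (NCAb.mk R x))) ∧
    -- the universal central extension of a `d`-smooth algebra exists, is `(d+1)`-smooth
    -- and has the same commutativization
    (∀ (d : ℕ) (R : Type u) [Ring R] [Algebra ℂ R], IsDSmooth d R →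
      (∃ (E : Type u) (_ : Ring E) (_ : Algebra ℂ E)
        (X : CentralExtension R (HochschildH2 R) E), X.IsUniversal) ∧
      ∀ (E : Type u) [Ring E] [Algebra ℂ E] (X : CentralExtension R (HochschildH2 R) E),
        X.IsUniversal →
        IsDSmooth (d + 1) E ∧
        ∃ ψ : NCAb E ≃ₐ[ℂ] NCAb R, ∀ x : E, ψ (NCAb.mk E x) = NCAb.mk R (X.proj x)) := by
  refine ⟨fun A _ _ _ => ⟨fun d => ⟨exists_dSmoothThickening A d, fun R R' _ _ _ _ T T' =>
    T.exists_algEquiv T'⟩, exists_ncSmoothThickening A, fun R R' _ _ _ _ T T' =>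
    T.exists_algEquiv T'⟩, fun d R _ _ hR => ⟨hR.exists_universal, fun E _ _ X hX =>
    ⟨hX.isDSmooth hR, hX.exists_ncAb_equiv hR⟩⟩⟩
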